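/- Let $(M,\xi,\eta,\phi,g)$ be a Sasakian 3-manifold: $g$ is a Riemannian metric on the smooth 3-manifold $M$, $\eta$ is a contact form ($\eta\wedge d\eta\neq 0$ everywhere) with Reeb field $\xi$ ($\eta(\xi)=1$, $d\eta(\xi,\cdot)=0$), $\phi$ is a $(1,1)$-tensor field with $\phi^2=-I+\eta\otimes\xi$, $\tfrac12 d\eta(\cdot,\cdot)=g(\cdot,\phi\,\cdot)$, $\eta=g(\cdot,\xi)$, and $\xi$ is a Killing field. Here $d\eta(X,Y)=X(\eta(Y))-Y(\eta(X))-\eta([X,Y])$, and $M$ is oriented by $\eta\wedge d\eta$. Write $\Delta=-\operatorname{div}\operatorname{grad}$ and $\operatorname{curl}u=(\ast\,du^\flat)^\sharp$. Let $F,G:\mathbb R\to\mathbb R$ and $\psi:M\to\mathbb R$ be smooth, and let $$u=F(\psi)\,\xi+\phi(\operatorname{grad}G(\psi)),$$ a smooth vector field on $M$. (i) For every $x\in M$, $(\operatorname{div}u)(x)=0$ if and only if $F'(\psi(x))=2G'(\psi(x))$ or $\xi(\psi)(x)=0$; so $u$ is divergence-free if and only if one of these two equations holds at each point. If moreover $F'-2G'$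 either vanishes identically on $\psi(M)$ or does not vanish identically on any non-empty open interval contained in $\psi(M)$, then $u$ is divergence-free if and only if $F'=2G'$ on $\psi(M)$ or $\xi(\psi)=0$ on $M$. (ii) If $G'(\psi)$ vanishes nowhere on $M$, $\xi(\psi)=0$ and $$\Delta G(\psi)=F(\psi)\left(\frac{F'(\psi)}{G'(\psi)}-2\right),$$ then $u$ is a Beltrami field with proportionality factor $\theta=F'(\psi)/G'(\psi)$, i.e. $\operatorname{div}u=0$ and $\operatorname{curl}u=\theta u$. In particular, let $M$ be the unit sphere $\mathbb S^3\subset\mathbb R^4$ with its standard metric and any Sasakian structure having this metric (such as the standard one, whose Reeb field is the Hopf field), let $k\in\mathbb Z$, let $\xi(\psi)=0$, and let $G(\psi)$ be an eigenfunction of the Laplacian for the eigenvalue $k(k-2)$: $\Delta G(\psi)=k(k-2)\,G(\psi)$ and $G(\psi)\not\equiv0$. Then $u=kG(\psi)\,\xi+\phi(\operatorname{grad}G(\psi))$ satisfies $\operatorname{div}u=0$ and $\operatorname{curl}u=k\,u$, and if $k\neq0$ then $u\not\equiv0$, so that $u$ is a curl eigenfield for the eigenvalue $k$. (iii) If $\xi(\psi)=0$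 and $\Delta G(\psi)=\mathcal G(\psi)$ for some smooth $\mathcal G:\mathbb R\to\mathbb R$, then $u$ is a steady solution of the Euler equations, $\nabla_u u=-\operatorname{grad}p$ and $\operatorname{div}u=0$, with the smooth pressure $$p=-\tfrac12\,|\operatorname{grad}G(\psi)|^2-\int_0^{\psi}\big(\mathcal G(q)+2F(q)\big)G'(q)\,dq .$$ -/

import Mathlib

open Bundle
open scoped Manifold ContDiff

universe u

namespace SasakianFlow

noncomputable section

set_option linter.unusedSectionVars false

section Riemannian

variable {E : Type*} [NormedAddCommGroup E] [NormedSpace ℝ E] [FiniteDimensional ℝ E]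
  {H : Type*} [TopologicalSpace H] (I : ModelWithCorners ℝ E H)
  {M : Type*} [TopologicalSpace M] [ChartedSpace H M] [IsManifold I ∞ M]
  [RiemannianBundle (fun x : M ↦ TangentSpace I x)]

/-- The function `x ↦ g(X, Y)(x)` for two vector fields `X`, `Y`. -/
def pairing (X Y : Π x : M, TangentSpace I x) (x : M) : ℝ := inner ℝ (X x) (Y x)

/-- The right-hand side of the Koszul formula, i.e. `g(∇_X Y, Z)` at the point `x`. -/
def koszul (X Y Z : Π x : M, TangentSpace I x) (x : M) : ℝ :=
  (1 / 2 : ℝ) *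
    (mvfderiv I (pairing I Y Z) x (X x)
      + mvfderiv I (pairing I Z X) x (Y x)
      - mvfderiv I (pairing I X Y) x (Z x)
      + inner ℝ (VectorField.mlieBracket I X Y x) (Z x)
      - inner ℝ (VectorField.mlieBracket I Y Z x) (X x)
      + inner ℝ (VectorField.mlieBracket I Z X x) (Y x))

variable [IsContMDiffRiemannianBundle I ∞ E
    (fun x : M ↦ TangentSpace I x)]

theorem mdifferentiableAt_pairing {X Y : Π x : M, TangentSpace I x} {x : M}
    (hX : MDiffAt (T% X) x) (hY : MDiffAt (T% Y) x) : MDiffAt (pairing I X Y) x :=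
  MDifferentiableAt.inner_bundle (IB := I) (F := E) (E := fun x : M ↦ TangentSpace I x) hX hY

theorem koszul_tensorial_left {Y Z : Π x : M, TangentSpace I x} {x : M}
    (hY : MDiffAt (T% Y) x) (hZ : MDiffAt (T% Z) x) :
    TensorialAt I E (fun X ↦ koszul I X Y Z x) x where
  smul {f X} hf hX := by
    have h1 : pairing I Z (f • X) = fun y ↦ f y * pairing I Z X y := by
      ext y; simp [pairing, inner_smul_right]
    have h2 : pairing I (f • X) Y = fun y ↦ f y * pairing I X Y y := by
      ext y; simp [pairing, inner_smul_left]
    have d1 : MDiffAt (pairing I Z X) x := mdifferentiableAt_pairing I hZ hX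
    have d2 : MDiffAt (pairing I X Y) x := mdifferentiableAt_pairing I hX hY
    simp only [koszul, h1, h2, mvfderiv_fun_mul hf d1, mvfderiv_fun_mul hf d2,
      VectorField.mlieBracket_smul_left hf hX, VectorField.mlieBracket_smul_right hf hX]
    simp [inner_add_left, inner_smul_left, inner_smul_right, pairing]
    rw [real_inner_comm (Z x) (X x)]
    ring
  add {X X'} hX hX' := by
    have h1 : pairing I Z (X + X') = fun y ↦ pairing I Z X y + pairing I Z X' y := by
      ext y; simp [pairing, inner_add_right]
    have h2 : pairing I (X + X') Y = fun y ↦ pairing I X Y y + pairing I X' Y y := by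
      ext y; simp [pairing, inner_add_left]
    simp only [koszul, h1, h2,
      mvfderiv_fun_add (mdifferentiableAt_pairing I hZ hX)
        (mdifferentiableAt_pairing I hZ hX'),
      mvfderiv_fun_add (mdifferentiableAt_pairing I hX hY)
        (mdifferentiableAt_pairing I hX' hY),
      VectorField.mlieBracket_add_left hX hX', VectorField.mlieBracket_add_right hX hX']
    simp [inner_add_left, inner_add_right]
    ring

theorem koszul_tensorial_right {X Y : Π x : M, TangentSpace I x} {x : M}
    (hX : MDiffAt (T% X) x) (hY : MDiffAt (T% Y) x) :
    TensorialAt I E (fun Z ↦ koszul I X Y Z x) x where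
  smul {f Z} hf hZ := by
    have h1 : pairing I Y (f • Z) = fun y ↦ f y * pairing I Y Z y := by
      ext y; simp [pairing, inner_smul_right]
    have h2 : pairing I (f • Z) X = fun y ↦ f y * pairing I Z X y := by
      ext y; simp [pairing, inner_smul_left]
    have d1 : MDiffAt (pairing I Y Z) x := mdifferentiableAt_pairing I hY hZ
    have d2 : MDiffAt (pairing I Z X) x := mdifferentiableAt_pairing I hZ hX
    simp only [koszul, h1, h2, mvfderiv_fun_mul hf d1, mvfderiv_fun_mul hf d2,
      VectorField.mlieBracket_smul_left hf hZ, VectorField.mlieBracket_smul_right hf hZ]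
    simp [inner_add_left, inner_smul_left, inner_smul_right, pairing]
    rw [real_inner_comm (Z x) (Y x)]
    ring
  add {Z Z'} hZ hZ' := by
    have h1 : pairing I Y (Z + Z') = fun y ↦ pairing I Y Z y + pairing I Y Z' y := by
      ext y; simp [pairing, inner_add_right]
    have h2 : pairing I (Z + Z') X = fun y ↦ pairing I Z X y + pairing I Z' X y := by
      ext y; simp [pairing, inner_add_left]
    simp only [koszul, h1, h2,
      mvfderiv_fun_add (mdifferentiableAt_pairing I hY hZ)
        (mdifferentiableAt_pairing I hY hZ'),
      mvfderiv_fun_add (mdifferentiableAt_pairing I hZ hX)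
        (mdifferentiableAt_pairing I hZ' hX),
      VectorField.mlieBracket_add_left hZ hZ', VectorField.mlieBracket_add_right hZ hZ']
    simp [inner_add_left, inner_add_right]
    ring


instance tangentSpace_finiteDimensional (x : M) : FiniteDimensional ℝ (TangentSpace I x) :=
  inferInstanceAs (FiniteDimensional ℝ E)

instance tangentSpace_completeSpace (x : M) : CompleteSpace (TangentSpace I x) :=
  FiniteDimensional.complete ℝ (TangentSpace I x)

/-- The Levi-Civita connection, defined by the Koszul formula: `leviCivita I Y x v` is the vector
`∇_v Y` at `x` with `g(∇_X Y, Z) = koszul I X Y Z`. It is set to zero where `Y` is not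
differentiable. -/
def leviCivita (Y : Π x : M, TangentSpace I x) (x : M) :
    TangentSpace I x →L[ℝ] TangentSpace I x :=
  open scoped Classical in
  if hY : MDiffAt (T% Y) x then
    InnerProductSpace.continuousLinearMapOfBilin (𝕜 := ℝ)
      (TensorialAt.mkHom₂ (fun X Z ↦ koszul I X Y Z x) x
        (fun _ hZ ↦ koszul_tensorial_left I hY hZ)
        (fun _ hX ↦ koszul_tensorial_right I hX hY))
  else 0

/-- The gradient of a function: `g(grad f, v) = df(v)`. -/
def grad (f : M → ℝ) (x : M) : TangentSpace I x :=
  (InnerProductSpace.toDual ℝ (TangentSpace I x)).symm (mvfderiv I f x)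

/-- The divergence of a vector field: the trace of `v ↦ ∇_v u`. -/
def div (u : Π x : M, TangentSpace I x) (x : M) : ℝ :=
  LinearMap.trace ℝ (TangentSpace I x) (leviCivita I u x).toLinearMap

/-- The nonnegative Laplacian `Δ = - div grad`. -/
def laplacian (f : M → ℝ) (x : M) : ℝ := - div I (grad I f) x

/-- The 1-form `g(u, ·)` dual to a vector field `u`. -/
def flat (u : Π x : M, TangentSpace I x) (x : M) : TangentSpace I x →L[ℝ] ℝ :=
  innerSL ℝ (u x)

/-- The exterior derivative of a 1-form `α`:
`dα(v, w) = V(α(W)) - W(α(V)) - α([V, W])` at `x`, where `V`, `W` are vector fields that extend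
`v`, `w`. -/
def extDerivOneForm (α : Π x : M, TangentSpace I x →L[ℝ] ℝ) (x : M) (v w : TangentSpace I x) : ℝ :=
  mvfderiv I (fun y ↦ α y (FiberBundle.extend E w y)) x v
    - mvfderiv I (fun y ↦ α y (FiberBundle.extend E v y)) x w
    - α x (VectorField.mlieBracket I (FiberBundle.extend E v) (FiberBundle.extend E w) x)

/-- `u` is a Killing field: `g(∇_v u, w) + g(v, ∇_w u) = 0`. -/
def IsKilling (u : Π x : M, TangentSpace I x) : Prop :=
  ∀ (x : M) (v w : TangentSpace I x),
    inner ℝ (leviCivita I u x v) w + inner ℝ v (leviCivita I u x w) = 0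

end Riemannian

section DimensionThree

variable {M : Type*} [TopologicalSpace M] [ChartedSpace (EuclideanSpace ℝ (Fin 3)) M]
  [IsManifold (𝓡 3) ∞ M] [RiemannianBundle (fun x : M ↦ TangentSpace (𝓡 3) x)]

theorem finrank_tangentSpace (x : M) : Module.finrank ℝ (TangentSpace (𝓡 3) x) = 3 :=
  finrank_euclideanSpace_fin (𝕜 := ℝ) (n := 3)

/-- The vorticity field `curl u = (∗ du♭)♯` for the metric and the orientation `o`: in an oriented
orthonormal basis `e` of the tangent space,
`curl u = du♭(e₁, e₂) e₀ + du♭(e₂, e₀) e₁ + du♭(e₀, e₁) e₂`. -/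
def curl (o : Π x : M, Orientation ℝ (TangentSpace (𝓡 3) x) (Fin 3))
    (u : Π x : M, TangentSpace (𝓡 3) x) (x : M) : TangentSpace (𝓡 3) x :=
  let e : OrthonormalBasis (Fin 3) ℝ (TangentSpace (𝓡 3) x) :=
    (o x).finOrthonormalBasis (by norm_num) (finrank_tangentSpace x)
  extDerivOneForm (𝓡 3) (flat (𝓡 3) u) x (e 1) (e 2) • e 0
    + extDerivOneForm (𝓡 3) (flat (𝓡 3) u) x (e 2) (e 0) • e 1
    + extDerivOneForm (𝓡 3) (flat (𝓡 3) u) x (e 0) (e 1) • e 2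

/-- The 3-form `α ∧ dα` of a 1-form `α`. -/
def wedgeSelfDeriv (α : Π x : M, TangentSpace (𝓡 3) x →L[ℝ] ℝ) (x : M)
    (v : Fin 3 → TangentSpace (𝓡 3) x) : ℝ :=
  α x (v 0) * extDerivOneForm (𝓡 3) α x (v 1) (v 2)
    + α x (v 1) * extDerivOneForm (𝓡 3) α x (v 2) (v 0)
    + α x (v 2) * extDerivOneForm (𝓡 3) α x (v 0) (v 1)

variable [IsContMDiffRiemannianBundle (𝓡 3) ∞ (EuclideanSpace ℝ (Fin 3))
    (fun x : M ↦ TangentSpace (𝓡 3) x)]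

variable (M) in
/-- A Sasakian structure `(ξ, η, φ, g)` on a Riemannian 3-manifold `(M, g)`: a contact form `η`
with Reeb field `ξ`, and a `(1,1)`-tensor field `φ` with `φ² = -I + η ⊗ ξ`, `½ dη = g(·, φ ·)`,
`η = g(·, ξ)`, such that `ξ` is a Killing field. -/
structure SasakianStructure where
  /-- the Reeb field -/
  ξ : Π x : M, TangentSpace (𝓡 3) x
  /-- the contact form -/
  η : Π x : M, TangentSpace (𝓡 3) x →L[ℝ] ℝ
  /-- the transverse complex structure -/
  φ : Π x : M, TangentSpace (𝓡 3) x →L[ℝ] TangentSpace (𝓡 3) x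
  contMDiff_ξ : ContMDiff (𝓡 3) (𝓡 3).tangent ∞ (fun x ↦ (⟨x, ξ x⟩ : TangentBundle (𝓡 3) M))
  contMDiff_η : ContMDiff (𝓡 3) ((𝓡 3).prod 𝓘(ℝ, EuclideanSpace ℝ (Fin 3) →L[ℝ] ℝ)) ∞
    (fun x ↦ TotalSpace.mk' (EuclideanSpace ℝ (Fin 3) →L[ℝ] ℝ)
      (E := fun x : M ↦ TangentSpace (𝓡 3) x →L[ℝ] ℝ) x (η x))
  contMDiff_φ : ContMDiff (𝓡 3)
    ((𝓡 3).prod 𝓘(ℝ, EuclideanSpace ℝ (Fin 3) →L[ℝ] EuclideanSpace ℝ (Fin 3))) ∞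
    (fun x ↦ TotalSpace.mk' (EuclideanSpace ℝ (Fin 3) →L[ℝ] EuclideanSpace ℝ (Fin 3))
      (E := fun x : M ↦ TangentSpace (𝓡 3) x →L[ℝ] TangentSpace (𝓡 3) x) x (φ x))
  contact : ∀ x, ∃ v, wedgeSelfDeriv η x v ≠ 0
  reeb_one : ∀ x, η x (ξ x) = 1
  reeb_deriv : ∀ x v, extDerivOneForm (𝓡 3) η x (ξ x) v = 0
  φ_sq : ∀ x v, φ x (φ x v) = - v + η x v • ξ x
  half_deriv : ∀ x v w, (1 / 2 : ℝ) * extDerivOneForm (𝓡 3) η x v w = inner ℝ v (φ x w)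
  η_eq : ∀ x v, η x v = inner ℝ v (ξ x)
  killing : IsKilling (𝓡 3) ξ

namespace SasakianStructure

/-- The orientation of a Sasakian 3-manifold given by the volume form `η ∧ dη`: a basis of the
tangent space is positively oriented if `η ∧ dη` is positive on it. -/
def orientation (S : SasakianStructure M) (x : M) : Orientation ℝ (TangentSpace (𝓡 3) x) (Fin 3) :=
  let b : Module.Basis (Fin 3) ℝ (TangentSpace (𝓡 3) x) :=
    (Module.finBasis ℝ (TangentSpace (𝓡 3) x)).reindex (finCongr (finrank_tangentSpace x))
  open scoped Classical in
  if 0 < wedgeSelfDeriv S.η x b then b.orientation else -b.orientation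

/-- The vector field `u = F(ψ) ξ + φ(grad G(ψ))`. -/
def ansatz (S : SasakianStructure M) (F G : ℝ → ℝ) (ψ : M → ℝ) (x : M) : TangentSpace (𝓡 3) x :=
  F (ψ x) • S.ξ x + S.φ x (grad (𝓡 3) (fun y ↦ G (ψ y)) x)

/-- `u` is a Beltrami field with proportionality factor `θ`: `div u = 0` and `curl u = θ u`, the
curl being taken with respect to the orientation `η ∧ dη`. -/
def IsBeltrami (S : SasakianStructure M) (u : Π x : M, TangentSpace (𝓡 3) x) (θ : M → ℝ) : Prop :=
  (∀ x, div (𝓡 3) u x = 0) ∧ ∀ x, curl S.orientation u x = θ x • u x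

end SasakianStructure

/-- `u` is a steady Euler field with smooth pressure `p`: `∇_u u = - grad p` and `div u = 0`. -/
def IsSteadyEuler (u : Π x : M, TangentSpace (𝓡 3) x) (p : M → ℝ) : Prop :=
  ContMDiff (𝓡 3) 𝓘(ℝ, ℝ) ∞ p ∧
    (∀ x, leviCivita (𝓡 3) u x (u x) = - grad (𝓡 3) p x) ∧ ∀ x, div (𝓡 3) u x = 0

end DimensionThree

section Sphere

/-- The unit 3-sphere in `ℝ⁴`. -/
abbrev S3 : Type := Metric.sphere (0 : EuclideanSpace ℝ (Fin 4)) 1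

instance fact_finrank_four : Fact (Module.finrank ℝ (EuclideanSpace ℝ (Fin 4)) = 3 + 1) :=
  ⟨finrank_euclideanSpace_fin (𝕜 := ℝ) (n := 4)⟩

/-- The metric of the 3-sphere is the standard one, induced by the inclusion in `ℝ⁴`. -/
def IsRound [RiemannianBundle (fun x : S3 ↦ TangentSpace (𝓡 3) x)] : Prop :=
  ∀ (x : S3) (v w : TangentSpace (𝓡 3) x),
    inner ℝ v w =
      inner ℝ (mvfderiv (𝓡 3) ((↑) : S3 → EuclideanSpace ℝ (Fin 4)) x v)
        (mvfderiv (𝓡 3) ((↑) : S3 → EuclideanSpace ℝ (Fin 4)) x w)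

end Sphere

end

end SasakianFlow

namespace SasakianFlow

noncomputable section

set_option linter.unusedSectionVars false

section LeviCivita

variable {E : Type*} [NormedAddCommGroup E] [NormedSpace ℝ E] [FiniteDimensional ℝ E]
  {H : Type*} [TopologicalSpace H] {I : ModelWithCorners ℝ E H}
  {M : Type*} [TopologicalSpace M] [ChartedSpace H M] [IsManifold I ∞ M]
  [RiemannianBundle (fun x : M ↦ TangentSpace I x)]

/-- Every tangent vector is the value of a vector field that is smooth at its base point. -/
theorem exists_contMDiffAt_eq (x : M) (v : TangentSpace I x) :
    ∃ V : Π y : M, TangentSpace I y, CMDiffAt ∞ (T% V) x ∧ V x = v :=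
  ⟨FiberBundle.extend E v, FiberBundle.contMDiffAt_extend I E v, FiberBundle.extend_apply_self E v⟩

theorem exists_mdifferentiableAt_eq (x : M) (v : TangentSpace I x) :
    ∃ V : Π y : M, TangentSpace I y, MDiffAt (T% V) x ∧ V x = v :=
  ⟨FiberBundle.extend E v, FiberBundle.mdifferentiableAt_extend I E v,
    FiberBundle.extend_apply_self E v⟩

theorem pairing_comm (X Y : Π x : M, TangentSpace I x) : pairing I X Y = pairing I Y X :=
  funext fun _ ↦ real_inner_comm _ _

variable [IsContMDiffRiemannianBundle I ∞ E (fun x : M ↦ TangentSpace I x)]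

/-- The Koszul formula for the Levi-Civita connection. -/
theorem inner_leviCivita {X Y Z : Π x : M, TangentSpace I x} {x : M}
    (hX : MDiffAt (T% X) x) (hY : MDiffAt (T% Y) x) (hZ : MDiffAt (T% Z) x) :
    inner ℝ (leviCivita I Y x (X x)) (Z x) = koszul I X Y Z x := by
  rw [leviCivita, dif_pos hY, InnerProductSpace.continuousLinearMapOfBilin_apply]
  exact TensorialAt.mkHom₂_apply (Φ := fun X Z ↦ koszul I X Y Z x) _ _ hX hZ

/-- The Levi-Civita connection is compatible with the metric. -/
theorem mvfderiv_pairing {Y Z : Π x : M, TangentSpace I x} {x : M}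
    (hY : MDiffAt (T% Y) x) (hZ : MDiffAt (T% Z) x) (v : TangentSpace I x) :
    mvfderiv I (pairing I Y Z) x v
      = inner ℝ (leviCivita I Y x v) (Z x) + inner ℝ (Y x) (leviCivita I Z x v) := by
  obtain ⟨X, hX, rfl⟩ := exists_mdifferentiableAt_eq x v
  rw [real_inner_comm _ (Y x), inner_leviCivita hX hY hZ, inner_leviCivita hX hZ hY]
  simp only [koszul, pairing_comm Z Y, pairing_comm X Y, pairing_comm Z X]
  rw [VectorField.mlieBracket_swap_apply (V := Z) (W := Y),
    VectorField.mlieBracket_swap_apply (V := X) (W := Y),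
    VectorField.mlieBracket_swap_apply (V := Z) (W := X)]
  simp only [inner_neg_left]
  ring

/-- The Levi-Civita connection is torsion-free. -/
theorem leviCivita_sub_leviCivita {X Y : Π x : M, TangentSpace I x} {x : M}
    (hX : MDiffAt (T% X) x) (hY : MDiffAt (T% Y) x) :
    leviCivita I Y x (X x) - leviCivita I X x (Y x) = VectorField.mlieBracket I X Y x := by
  refine ext_inner_right ℝ fun w ↦ ?_
  obtain ⟨Z, hZ, rfl⟩ := exists_mdifferentiableAt_eq x w
  rw [inner_sub_left, inner_leviCivita hX hY hZ, inner_leviCivita hY hX hZ]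
  simp only [koszul, pairing_comm Z Y, pairing_comm Y X, pairing_comm Z X]
  rw [VectorField.mlieBracket_swap_apply (V := Z) (W := Y),
    VectorField.mlieBracket_swap_apply (V := Y) (W := X),
    VectorField.mlieBracket_swap_apply (V := Z) (W := X)]
  simp only [inner_neg_left]
  ring

theorem inner_leviCivita_eq {Y Z : Π x : M, TangentSpace I x} {x : M}
    (hY : MDiffAt (T% Y) x) (hZ : MDiffAt (T% Z) x) (v : TangentSpace I x) :
    inner ℝ (leviCivita I Y x v) (Z x)
      = mvfderiv I (pairing I Y Z) x v - inner ℝ (Y x) (leviCivita I Z x v) := by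
  rw [mvfderiv_pairing hY hZ]; ring

theorem leviCivita_add {Y Z : Π x : M, TangentSpace I x} {x : M}
    (hY : MDiffAt (T% Y) x) (hZ : MDiffAt (T% Z) x) (v : TangentSpace I x) :
    leviCivita I (Y + Z) x v = leviCivita I Y x v + leviCivita I Z x v := by
  refine ext_inner_right ℝ fun w ↦ ?_
  obtain ⟨W, hW, rfl⟩ := exists_mdifferentiableAt_eq x w
  have hYZ : MDiffAt (T% (Y + Z)) x := mdifferentiableAt_add_section hY hZ
  have h : pairing I (Y + Z) W = fun y ↦ pairing I Y W y + pairing I Z W y := by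
    ext y; simp [pairing, inner_add_left]
  rw [inner_add_left, inner_leviCivita_eq hYZ hW, inner_leviCivita_eq hY hW,
    inner_leviCivita_eq hZ hW, h, mvfderiv_fun_add (mdifferentiableAt_pairing I hY hW)
    (mdifferentiableAt_pairing I hZ hW)]
  simp only [add_apply, Pi.add_apply, inner_add_left]
  ring

theorem leviCivita_smul {f : M → ℝ} {Y : Π x : M, TangentSpace I x} {x : M}
    (hf : MDiffAt f x) (hY : MDiffAt (T% Y) x) (v : TangentSpace I x) :
    leviCivita I (fun y ↦ f y • Y y) x v = mvfderiv I f x v • Y x + f x • leviCivita I Y x v := by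
  refine ext_inner_right ℝ fun w ↦ ?_
  obtain ⟨W, hW, rfl⟩ := exists_mdifferentiableAt_eq x w
  have hfY : MDiffAt (T% (fun y ↦ f y • Y y)) x := hf.smul_section hY
  have h : pairing I (fun y ↦ f y • Y y) W = fun y ↦ f y * pairing I Y W y := by
    ext y; simp [pairing, inner_smul_left]
  rw [inner_add_left, inner_leviCivita_eq hfY hW, h,
    mvfderiv_fun_mul hf (mdifferentiableAt_pairing I hY hW)]
  simp only [add_apply, smul_apply, inner_smul_left,
    mvfderiv_pairing hY hW, smul_eq_mul, pairing, conj_trivial]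
  ring

/-- The exterior derivative of `g(u, ·)` in terms of the Levi-Civita connection. -/
theorem extDerivOneForm_flat {u : Π x : M, TangentSpace I x} {x : M}
    (hu : MDiffAt (T% u) x) (v w : TangentSpace I x) :
    extDerivOneForm I (flat I u) x v w
      = inner ℝ (leviCivita I u x v) w - inner ℝ (leviCivita I u x w) v := by
  have hV : MDiffAt (T% (FiberBundle.extend E v : Π y : M, TangentSpace I y)) x :=
    FiberBundle.mdifferentiableAt_extend I E v
  have hW : MDiffAt (T% (FiberBundle.extend E w : Π y : M, TangentSpace I y)) x :=
    FiberBundle.mdifferentiableAt_extend I E w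
  have h1 := mvfderiv_pairing hu hW v
  have h2 := mvfderiv_pairing hu hV w
  have h3 := leviCivita_sub_leviCivita hV hW
  simp only [FiberBundle.extend_apply_self] at h1 h2 h3
  simp only [extDerivOneForm, flat, innerSL_apply_apply, ← h3, inner_sub_right]
  unfold pairing at h1 h2
  rw [h1, h2]
  ring

end LeviCivita

section Gradient

variable {E : Type*} [NormedAddCommGroup E] [NormedSpace ℝ E] [FiniteDimensional ℝ E]
  {H : Type*} [TopologicalSpace H] {I : ModelWithCorners ℝ E H}
  {M : Type*} [TopologicalSpace M] [ChartedSpace H M] [IsManifold I ∞ M]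

theorem contMDiffAt_mvfderiv_apply {f : M → ℝ} (hf : ContMDiff I 𝓘(ℝ, ℝ) ∞ f)
    {V : Π x : M, TangentSpace I x} {x : M} (hV : CMDiffAt ∞ (T% V) x) :
    CMDiffAt ∞ (fun y ↦ mvfderiv I f y (V y)) x := by
  have h1 : ContMDiff I.tangent 𝓘(ℝ, ℝ).tangent ∞ (tangentMap I 𝓘(ℝ, ℝ) f) :=
    hf.contMDiff_tangentMap le_rfl
  have h2 := (contMDiff_snd_tangentBundle_modelSpace ℝ 𝓘(ℝ, ℝ) (n := ∞)).comp h1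
  exact h2.contMDiffAt.comp x hV

theorem mlieBracket_mlieBracket_smul [CompleteSpace E] {f : M → ℝ} (hf : ContMDiff I 𝓘(ℝ, ℝ) ∞ f)
    {U V W : Π x : M, TangentSpace I x} {x : M} (hU : CMDiffAt ∞ (T% U) x)
    (hW : CMDiffAt ∞ (T% W) x) :
    VectorField.mlieBracket I V (VectorField.mlieBracket I W (f • U)) x
      = mvfderiv I (fun y ↦ mvfderiv I f y (W y)) x (V x) • U x
        + mvfderiv I f x (W x) • VectorField.mlieBracket I V U x
        + mvfderiv I f x (V x) • VectorField.mlieBracket I W U x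
        + f x • VectorField.mlieBracket I V (VectorField.mlieBracket I W U) x := by
  have hf' : MDifferentiable I 𝓘(ℝ, ℝ) f := hf.mdifferentiable (by simp)
  have hWf : MDiffAt (fun y ↦ mvfderiv I f y (W y)) x :=
    (contMDiffAt_mvfderiv_apply hf hW).mdifferentiableAt (by simp)
  have hUx : MDiffAt (T% U) x := hU.mdifferentiableAt (by simp)
  have hWU : MDiffAt (T% (VectorField.mlieBracket I W U)) x := by
    have : CMDiffAt ((1 : ℕ∞) : WithTop ℕ∞) (T% (VectorField.mlieBracket I W U)) x :=
      have : IsManifold I (((2 : ℕ∞) : WithTop ℕ∞) + 1) M := IsManifold.of_le (n := ∞) (by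
        exact_mod_cast le_top)
      have : IsManifold I (minSmoothness ℝ 2) M := IsManifold.of_le (n := ∞) (by
        simp only [minSmoothness_of_isRCLikeNormedField]
        exact WithTop.coe_le_coe.2 le_top)
      ContMDiffAt.mlieBracket_vectorField (n := 2) (hW.of_le (by exact_mod_cast le_top))
        (hU.of_le (by exact_mod_cast le_top)) (by norm_num [one_add_one_eq_two])
    exact this.mdifferentiableAt (by simp)
  have hev : VectorField.mlieBracket I W (f • U) =ᶠ[nhds x]
      (fun y ↦ mvfderiv I f y (W y)) • U + f • VectorField.mlieBracket I W U := by
    have hU1 : CMDiffAt 1 (T% U) x := hU.of_le (by exact_mod_cast le_top)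
    filter_upwards [(contMDiffAt_iff_contMDiffAt_nhds (by simp)).1 hU1] with y hy
    rw [VectorField.mlieBracket_smul_right (hf' y) (hy.mdifferentiableAt (by simp))]
    rfl
  rw [(Filter.EventuallyEq.refl _ V).mlieBracket_vectorField_eq hev,
    VectorField.mlieBracket_add_right (hWf.smul_section hUx) ((hf' x).smul_section hWU),
    VectorField.mlieBracket_smul_right hWf hUx, VectorField.mlieBracket_smul_right (hf' x) hWU]
  abel

/-- The Lie bracket of vector fields is the commutator of the corresponding derivations. -/
theorem mvfderiv_mlieBracket {f : M → ℝ} (hf : ContMDiff I 𝓘(ℝ, ℝ) ∞ f)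
    {V W : Π x : M, TangentSpace I x} {x : M} (hV : CMDiffAt ∞ (T% V) x)
    (hW : CMDiffAt ∞ (T% W) x) :
    mvfderiv I f x (VectorField.mlieBracket I V W x)
      = mvfderiv I (fun y ↦ mvfderiv I f y (W y)) x (V x)
        - mvfderiv I (fun y ↦ mvfderiv I f y (V y)) x (W x) := by
  have : CompleteSpace E := FiniteDimensional.complete ℝ E
  rcases subsingleton_or_nontrivial E with hE | hE
  · have h (v : TangentSpace I x) : v = 0 := hE.elim (α := E) v 0
    rw [h (V x), h (W x), h (VectorField.mlieBracket I V W x)]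
    simp
  obtain ⟨v, hv⟩ := exists_ne (0 : E)
  let U : Π y : M, TangentSpace I y := FiberBundle.extend E (show TangentSpace I x from v)
  have hU : CMDiffAt ∞ (T% U) x := FiberBundle.contMDiffAt_extend I E _
  have hUx : U x = v := FiberBundle.extend_apply_self E (show TangentSpace I x from v)
  have hf' : MDiffAt f x := hf.mdifferentiableAt (by simp)
  have hU' : MDiffAt (T% U) x := hU.mdifferentiableAt (by simp)
  have hfU : CMDiffAt ∞ (T% (f • U)) x := hf.contMDiffAt.smul_section hU
  have : IsManifold I (minSmoothness ℝ 3) M := IsManifold.of_le (n := ∞) (by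
    simp only [minSmoothness_of_isRCLikeNormedField]; exact WithTop.coe_le_coe.2 le_top)
  have hle : minSmoothness ℝ 2 ≤ (∞ : WithTop ℕ∞) := by
    simp only [minSmoothness_of_isRCLikeNormedField]; exact WithTop.coe_le_coe.2 le_top
  have j1 := VectorField.leibniz_identity_mlieBracket_apply (hV.of_le hle) (hW.of_le hle)
    (hfU.of_le hle)
  have j2 := VectorField.leibniz_identity_mlieBracket_apply (hV.of_le hle) (hW.of_le hle)
    (hU.of_le hle)
  rw [mlieBracket_mlieBracket_smul hf hU hW, mlieBracket_mlieBracket_smul hf hU hV,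
    VectorField.mlieBracket_smul_right hf' hU', j2] at j1
  have key : (mvfderiv I f x (VectorField.mlieBracket I V W x)
      - (mvfderiv I (fun y ↦ mvfderiv I f y (W y)) x (V x)
        - mvfderiv I (fun y ↦ mvfderiv I f y (V y)) x (W x))) • U x = 0 := by
    rw [sub_smul, sub_smul]
    rw [← sub_eq_zero, ← neg_eq_zero] at j1
    rw [← j1]
    module
  rw [hUx] at key
  exact sub_eq_zero.1 ((smul_eq_zero.1 key).resolve_right hv)

variable [RiemannianBundle (fun x : M ↦ TangentSpace I x)]

theorem inner_grad (f : M → ℝ) (x : M) (v : TangentSpace I x) :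
    inner ℝ (grad I f x) v = mvfderiv I f x v := by
  simp [grad]

theorem pairing_grad (f : M → ℝ) (V : Π x : M, TangentSpace I x) :
    pairing I (grad I f) V = fun y ↦ mvfderiv I f y (V y) :=
  funext fun y ↦ inner_grad f y (V y)

variable [IsContMDiffRiemannianBundle I ∞ E (fun x : M ↦ TangentSpace I x)]

/-- The Gram matrix of a family of vectors detects linear independence. -/
theorem linearIndependent_of_det_gram_ne_zero {V ι : Type*} [NormedAddCommGroup V]
    [InnerProductSpace ℝ V] [Fintype ι] [DecidableEq ι] {s : ι → V}
    (h : (Matrix.of fun i j ↦ (inner ℝ (s i) (s j) : ℝ)).det ≠ 0) : LinearIndependent ℝ s := by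
  rw [Fintype.linearIndependent_iff]
  intro a ha
  have h0 := Matrix.eq_zero_of_mulVec_eq_zero h (v := a) (by
    ext i
    simp only [Matrix.mulVec, dotProduct, Matrix.of_apply, Pi.zero_apply]
    rw [← inner_zero_right (𝕜 := ℝ) (s i), ← ha, inner_sum]
    exact Finset.sum_congr rfl fun j _ ↦ by rw [real_inner_smul_right, mul_comm])
  exact fun i ↦ congrFun h0 i

/-- A vector field whose inner product with every smooth vector field is smooth is smooth. -/
theorem contMDiffAt_of_pairing {W : Π x : M, TangentSpace I x} {x : M}
    (h : ∀ V : Π x : M, TangentSpace I x, CMDiffAt ∞ (T% V) x → CMDiffAt ∞ (pairing I W V) x) :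
    CMDiffAt ∞ (T% W) x := by
  let b := stdOrthonormalBasis ℝ (TangentSpace I x)
  let s : Fin (Module.finrank ℝ (TangentSpace I x)) → Π y : M, TangentSpace I y :=
    fun i ↦ FiberBundle.extend E (b i)
  have hs (i) : CMDiffAt ∞ (T% (s i)) x := FiberBundle.contMDiffAt_extend I E _
  have hsx (i) : s i x = b i := FiberBundle.extend_apply_self E (b i)
  let A : M → Matrix (Fin (Module.finrank ℝ (TangentSpace I x)))
    (Fin (Module.finrank ℝ (TangentSpace I x))) ℝ := fun y ↦
      Matrix.of fun i j ↦ inner ℝ (s i y) (s j y)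
  have hA (i j) : CMDiffAt ∞ (fun y ↦ A y i j) x :=
    ContMDiffAt.inner_bundle (IB := I) (F := E) (E := fun x : M ↦ TangentSpace I x) (hs i) (hs j)
  have hdet_of {B : M → Matrix (Fin (Module.finrank ℝ (TangentSpace I x)))
      (Fin (Module.finrank ℝ (TangentSpace I x))) ℝ}
      (hB : ∀ i j, CMDiffAt ∞ (fun y ↦ B y i j) x) : CMDiffAt ∞ (fun y ↦ (B y).det) x := by
    simp only [Matrix.det_apply']
    exact contMDiffAt_finsetSum fun σ _ ↦
      contMDiffAt_const.mul (contMDiffAt_finsetProd fun i _ ↦ hB _ _)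
  have hdet : CMDiffAt ∞ (fun y ↦ (A y).det) x := hdet_of hA
  have hAx : (A x).det = 1 := by
    have : A x = 1 := by
      ext i j
      simp [A, hsx, Matrix.one_apply, orthonormal_iff_ite.1 b.orthonormal]
    rw [this, Matrix.det_one]
  have hne : ∀ᶠ y in nhds x, (A y).det ≠ 0 :=
    hdet.continuousAt.eventually_ne (by rw [hAx]; exact one_ne_zero)
  let c : Fin (Module.finrank ℝ (TangentSpace I x)) → M → ℝ := fun i y ↦
    (A y).det⁻¹ * ∑ j, (A y).adjugate i j * pairing I W (s j) y
  have hc (i) : CMDiffAt ∞ (c i) x := by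
    refine ContMDiffAt.mul ?_ (contMDiffAt_finsetSum fun j _ ↦ ContMDiffAt.mul ?_ (h _ (hs j)))
    · exact ((contDiffAt_inv ℝ (by rw [hAx]; exact one_ne_zero)).contMDiffAt).comp x hdet
    · simp only [Matrix.adjugate_apply]
      refine hdet_of fun k l ↦ ?_
      simp only [Matrix.updateRow_apply]
      split_ifs
      · exact contMDiffAt_const
      · exact hA k l
  have hsum : CMDiffAt ∞ (T% (fun y ↦ ∑ i, c i y • s i y)) x :=
    ContMDiffAt.sum_section fun i _ ↦ (hc i).smul_section (hs i)
  refine hsum.congr_of_eventuallyEq ?_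
  filter_upwards [hne] with y hy
  have hli : LinearIndependent ℝ fun i ↦ s i y := linearIndependent_of_det_gram_ne_zero hy
  have hspan := hli.span_eq_top_of_card_eq_finrank' (by
    rw [Fintype.card_fin]; rfl)
  have : W y = ∑ i, c i y • s i y := by
    let B := Module.Basis.mk hli hspan.ge
    refine InnerProductSpace.ext_inner_left_basis B fun j ↦ ?_
    have hB : B j = s j y := Module.Basis.mk_apply hli hspan.ge j
    have hmul : (A y).mulVec (fun i ↦ c i y) = fun j ↦ pairing I W (s j) y := by
      have : (fun i ↦ c i y) = ((A y)⁻¹).mulVec fun j ↦ pairing I W (s j) y := by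
        ext i
        simp [c, Matrix.inv_def, Matrix.mulVec, dotProduct, Finset.mul_sum, mul_assoc]
      rw [this, Matrix.mulVec_mulVec, Matrix.mul_nonsing_inv _ (isUnit_iff_ne_zero.2 hy),
        Matrix.one_mulVec]
    rw [hB, real_inner_comm, inner_sum]
    refine (congrFun hmul j).symm.trans ?_
    simp [Matrix.mulVec, dotProduct, A, inner_smul_right, mul_comm]
  simp only [this]

theorem contMDiff_grad {f : M → ℝ} (hf : ContMDiff I 𝓘(ℝ, ℝ) ∞ f) :
    CMDiff ∞ (T% (grad I f)) := fun x ↦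
  contMDiffAt_of_pairing fun V hV ↦ by
    rw [pairing_grad]; exact contMDiffAt_mvfderiv_apply hf hV

/-- The Hessian of a function is symmetric. -/
theorem inner_leviCivita_grad_comm {f : M → ℝ} (hf : ContMDiff I 𝓘(ℝ, ℝ) ∞ f) {x : M}
    (v w : TangentSpace I x) :
    inner ℝ (leviCivita I (grad I f) x v) w = inner ℝ (leviCivita I (grad I f) x w) v := by
  obtain ⟨V, hV, rfl⟩ := exists_contMDiffAt_eq x v
  obtain ⟨W, hW, rfl⟩ := exists_contMDiffAt_eq x w
  have hV' : MDiffAt (T% V) x := hV.mdifferentiableAt (by simp)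
  have hW' : MDiffAt (T% W) x := hW.mdifferentiableAt (by simp)
  have hg : MDiffAt (T% (grad I f)) x := (contMDiff_grad hf x).mdifferentiableAt (by simp)
  have h := mvfderiv_mlieBracket hf hV hW
  rw [← leviCivita_sub_leviCivita hV' hW', ← inner_grad, inner_sub_right] at h
  rw [inner_leviCivita_eq hg hW', inner_leviCivita_eq hg hV', pairing_grad, pairing_grad]
  linarith

end Gradient

section LinearAlgebra

variable {V : Type*} [NormedAddCommGroup V] [InnerProductSpace ℝ V]

theorem exists_eq_sum_three (e : OrthonormalBasis (Fin 3) ℝ V) (v : V) :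
    ∃ a b c : ℝ, v = a • e 0 + b • e 1 + c • e 2 :=
  ⟨_, _, _, by rw [← Fin.sum_univ_three (fun i ↦ inner ℝ (e i) v • e i), e.sum_repr']⟩

theorem inner_three (e : OrthonormalBasis (Fin 3) ℝ V) :
    (inner ℝ (e 0) (e 0) : ℝ) = 1 ∧ (inner ℝ (e 0) (e 1) : ℝ) = 0 ∧ (inner ℝ (e 0) (e 2) : ℝ) = 0 ∧
    (inner ℝ (e 1) (e 0) : ℝ) = 0 ∧ (inner ℝ (e 1) (e 1) : ℝ) = 1 ∧ (inner ℝ (e 1) (e 2) : ℝ) = 0 ∧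
    (inner ℝ (e 2) (e 0) : ℝ) = 0 ∧ (inner ℝ (e 2) (e 1) : ℝ) = 0 ∧
      (inner ℝ (e 2) (e 2) : ℝ) = 1 := by
  simp [orthonormal_iff_ite.1 e.orthonormal]

/-- A skew endomorphism `φ` of a 3-dimensional space with `φ² = -1 + ⟨·, ξ⟩ ξ` is the rotation by a
right angle in the plane orthogonal to the unit vector `ξ`. -/
theorem exists_adapted_basis (hV : Module.finrank ℝ V = 3) {ξ : V} {φ : V →L[ℝ] V}
    (hξ : (inner ℝ ξ ξ : ℝ) = 1) (hφξ : φ ξ = 0)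
    (hφ : ∀ v w, (inner ℝ v (φ w) : ℝ) = - inner ℝ (φ v) w)
    (hsq : ∀ v, φ (φ v) = - v + (inner ℝ v ξ : ℝ) • ξ) :
    ∃ e : OrthonormalBasis (Fin 3) ℝ V, e 0 = ξ ∧ φ (e 1) = e 2 ∧ φ (e 2) = - e 1 := by
  have : FiniteDimensional ℝ V := Module.finite_of_finrank_eq_succ hV
  have hξn : ‖ξ‖ = 1 := by rw [norm_eq_sqrt_real_inner, hξ, Real.sqrt_one]
  obtain ⟨b, hb⟩ := Orthonormal.exists_orthonormalBasis_extension_of_card_eq (𝕜 := ℝ) (ι := Fin 3)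
    (by simp [hV]) (v := fun _ ↦ ξ) (s := {0}) (by
      rw [orthonormal_iff_ite]
      rintro ⟨i, rfl⟩ ⟨j, rfl⟩
      simp [hξn])
  have hb0 : b 0 = ξ := hb 0 rfl
  obtain ⟨-, -, -, h10, h11, -⟩ := inner_three b
  rw [hb0] at h10
  have h1φ : (inner ℝ (b 1) (φ (b 1)) : ℝ) = 0 := by
    have := hφ (b 1) (b 1)
    rw [real_inner_comm] at this
    rw [real_inner_comm]; linarith
  have hξφ (v : V) : (inner ℝ ξ (φ v) : ℝ) = 0 := by rw [hφ, hφξ]; simp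
  have hφφ : (inner ℝ (φ (b 1)) (φ (b 1)) : ℝ) = 1 := by
    rw [← neg_eq_iff_eq_neg.2 (hφ (b 1) (φ (b 1))), hsq, h10]
    simp
  have hφn : ‖φ (b 1)‖ = 1 := by rw [norm_eq_sqrt_real_inner, hφφ, Real.sqrt_one]
  obtain ⟨e, he⟩ := Orthonormal.exists_orthonormalBasis_extension_of_card_eq (𝕜 := ℝ) (ι := Fin 3)
    (by simp [hV]) (v := ![ξ, b 1, φ (b 1)]) (s := Set.univ) (by
      rw [orthonormal_iff_ite]
      rintro ⟨i, -⟩ ⟨j, -⟩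
      fin_cases i <;> fin_cases j <;>
        simp [hξn, h10, h1φ, hξφ, hφn, real_inner_comm (b 1) ξ,
          real_inner_comm (b 1) (φ (b 1)), real_inner_comm ξ (φ (b 1))])
  have h0 : e 0 = ξ := he 0 trivial
  have h1 : e 1 = b 1 := he 1 trivial
  have h2 : e 2 = φ (b 1) := he 2 trivial
  exact ⟨e, h0, by rw [h1, h2], by rw [h1, h2, hsq, h10]; simp⟩

end LinearAlgebra

namespace SasakianStructure

variable {M : Type*} [TopologicalSpace M] [ChartedSpace (EuclideanSpace ℝ (Fin 3)) M]
  [IsManifold (𝓡 3) ∞ M] [RiemannianBundle (fun x : M ↦ TangentSpace (𝓡 3) x)]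
  [IsContMDiffRiemannianBundle (𝓡 3) ∞ (EuclideanSpace ℝ (Fin 3))
    (fun x : M ↦ TangentSpace (𝓡 3) x)]
  (S : SasakianStructure M)

/-- A vector field that is differentiable at a point. -/
abbrev FieldDiffAt (X : Π x : M, TangentSpace (𝓡 3) x) (x : M) : Prop :=
  MDifferentiableAt (𝓡 3) (𝓡 3).tangent (fun y ↦ (⟨y, X y⟩ : TangentBundle (𝓡 3) M)) x

/-- A smooth vector field. -/
abbrev SmoothField (X : Π x : M, TangentSpace (𝓡 3) x) : Prop :=
  ContMDiff (𝓡 3) (𝓡 3).tangent ∞ (fun y ↦ (⟨y, X y⟩ : TangentBundle (𝓡 3) M))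

theorem mdifferentiableAt_ξ (x : M) : FieldDiffAt S.ξ x :=
  (S.contMDiff_ξ x).mdifferentiableAt (by simp)

theorem η_eq_flat : S.η = flat (𝓡 3) S.ξ := by
  ext x v
  rw [S.η_eq, real_inner_comm]
  rfl

theorem inner_ξ_ξ (x : M) : (inner ℝ (S.ξ x) (S.ξ x) : ℝ) = 1 := by
  rw [← S.η_eq, S.reeb_one]

theorem φ_φ (x : M) (v : TangentSpace (𝓡 3) x) :
    S.φ x (S.φ x v) = - v + (inner ℝ v (S.ξ x) : ℝ) • S.ξ x := by
  rw [S.φ_sq, S.η_eq]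

theorem extDerivOneForm_η (x : M) (v w : TangentSpace (𝓡 3) x) :
    extDerivOneForm (𝓡 3) S.η x v w = 2 * inner ℝ v (S.φ x w) := by
  rw [← S.half_deriv]; ring

theorem leviCivita_ξ (x : M) (v : TangentSpace (𝓡 3) x) :
    leviCivita (𝓡 3) S.ξ x v = - S.φ x v := by
  refine ext_inner_left ℝ fun w ↦ ?_
  have h1 := S.extDerivOneForm_η x w v
  have h2 := S.killing x w v
  rw [η_eq_flat, extDerivOneForm_flat (S.mdifferentiableAt_ξ x)] at h1
  rw [inner_neg_right]
  rw [real_inner_comm] at h1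
  rw [real_inner_comm w (leviCivita _ _ _ v)] at h1
  rw [real_inner_comm] at h2
  linarith

theorem inner_φ (x : M) (v w : TangentSpace (𝓡 3) x) :
    (inner ℝ v (S.φ x w) : ℝ) = - inner ℝ (S.φ x v) w := by
  have h := S.killing x v w
  simp only [leviCivita_ξ, inner_neg_left, inner_neg_right] at h
  linarith

theorem φ_ξ (x : M) : S.φ x (S.ξ x) = 0 := by
  refine ext_inner_right ℝ fun v ↦ ?_
  have h := S.extDerivOneForm_η x (S.ξ x) v
  rw [S.reeb_deriv, S.inner_φ] at h
  rw [inner_zero_left]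
  linarith

theorem inner_ξ_φ (x : M) (v : TangentSpace (𝓡 3) x) :
    (inner ℝ (S.ξ x) (S.φ x v) : ℝ) = 0 := by
  rw [S.inner_φ, S.φ_ξ, inner_zero_left, neg_zero]

theorem inner_φ_φ (x : M) (v w : TangentSpace (𝓡 3) x) :
    (inner ℝ (S.φ x v) (S.φ x w) : ℝ)
      = inner ℝ v w - inner ℝ v (S.ξ x) * inner ℝ w (S.ξ x) := by
  rw [S.inner_φ, S.φ_φ, inner_add_left, inner_neg_left, inner_smul_left, real_inner_comm w,
    conj_trivial]
  rw [real_inner_comm w (S.ξ x)]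
  ring

theorem exists_adapted_basis (x : M) :
    ∃ e : OrthonormalBasis (Fin 3) ℝ (TangentSpace (𝓡 3) x),
      e 0 = S.ξ x ∧ S.φ x (e 1) = e 2 ∧ S.φ x (e 2) = - e 1 :=
  SasakianFlow.exists_adapted_basis (finrank_tangentSpace x) (S.inner_ξ_ξ x) (S.φ_ξ x)
    (S.inner_φ x) (S.φ_φ x)

theorem mdifferentiableAt_φ {W : Π x : M, TangentSpace (𝓡 3) x} {x : M}
    (hW : FieldDiffAt W x) : FieldDiffAt (fun y ↦ S.φ y (W y)) x :=
  MDifferentiableAt.clm_bundle_apply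
    (E₁ := fun x : M ↦ TangentSpace (𝓡 3) x) (E₂ := fun x : M ↦ TangentSpace (𝓡 3) x)
    ((S.contMDiff_φ x).mdifferentiableAt (by simp)) hW

theorem contMDiff_φ_apply {W : Π x : M, TangentSpace (𝓡 3) x}
    (hW : SmoothField W) : SmoothField (fun y ↦ S.φ y (W y)) := fun x ↦
  ContMDiffAt.clm_bundle_apply
    (E₁ := fun x : M ↦ TangentSpace (𝓡 3) x) (E₂ := fun x : M ↦ TangentSpace (𝓡 3) x)
    (S.contMDiff_φ x) (hW x)

/-- The covariant derivative of `φ` applied to a vector field. -/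
def derivφ (W : Π x : M, TangentSpace (𝓡 3) x) (x : M) (v : TangentSpace (𝓡 3) x) :
    TangentSpace (𝓡 3) x :=
  leviCivita (𝓡 3) (fun y ↦ S.φ y (W y)) x v - S.φ x (leviCivita (𝓡 3) W x v)

theorem inner_derivφ_skew {W Z : Π x : M, TangentSpace (𝓡 3) x} {x : M}
    (hW : FieldDiffAt W x) (hZ : FieldDiffAt Z x) (v : TangentSpace (𝓡 3) x) :
    (inner ℝ (S.derivφ W x v) (Z x) : ℝ) = - inner ℝ (W x) (S.derivφ Z x v) := by
  have h : pairing (𝓡 3) (fun y ↦ S.φ y (W y)) Z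
      = -pairing (𝓡 3) W (fun y ↦ S.φ y (Z y)) := by
    ext y; simp [pairing, S.inner_φ]
  have h1 := mvfderiv_pairing (S.mdifferentiableAt_φ hW) hZ v
  have h2 := mvfderiv_pairing hW (S.mdifferentiableAt_φ hZ) v
  rw [h, mvfderiv_neg, neg_apply, h2] at h1
  have h3 := S.inner_φ x (W x) (leviCivita (𝓡 3) Z x v)
  have h4 := S.inner_φ x (leviCivita (𝓡 3) W x v) (Z x)
  simp only [derivφ, inner_sub_left, inner_sub_right]
  linarith

theorem derivφ_ξ (x : M) (v : TangentSpace (𝓡 3) x) :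
    S.derivφ S.ξ x v = - v + (inner ℝ v (S.ξ x) : ℝ) • S.ξ x := by
  have h : (fun y ↦ S.φ y (S.ξ y)) = fun y ↦ (0 : ℝ) • S.ξ y := by
    ext1 y; rw [S.φ_ξ, zero_smul]
  rw [derivφ, h, leviCivita_smul mdifferentiableAt_const (S.mdifferentiableAt_ξ x),
    mvfderiv_const, S.leviCivita_ξ, map_neg, S.φ_φ]
  simp

theorem inner_derivφ_φ {W Z : Π x : M, TangentSpace (𝓡 3) x} {x : M}
    (hW : FieldDiffAt W x) (hZ : FieldDiffAt Z x) (v : TangentSpace (𝓡 3) x) :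
    (inner ℝ (S.derivφ W x v) (S.φ x (Z x)) : ℝ) + inner ℝ (S.φ x (W x)) (S.derivφ Z x v)
      = inner ℝ (W x) (S.φ x v) * inner ℝ (Z x) (S.ξ x)
        + inner ℝ (W x) (S.ξ x) * inner ℝ (Z x) (S.φ x v) := by
  have h : pairing (𝓡 3) (fun y ↦ S.φ y (W y)) (fun y ↦ S.φ y (Z y))
      = pairing (𝓡 3) W Z - pairing (𝓡 3) W S.ξ * pairing (𝓡 3) Z S.ξ := by
    ext y; simp [pairing, S.inner_φ_φ]
  have hξ := S.mdifferentiableAt_ξ x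
  have h1 := mvfderiv_pairing (S.mdifferentiableAt_φ hW) (S.mdifferentiableAt_φ hZ) v
  have d1 := mdifferentiableAt_pairing (𝓡 3) hW hZ
  have d2 := mdifferentiableAt_pairing (𝓡 3) hW hξ
  have d3 := mdifferentiableAt_pairing (𝓡 3) hZ hξ
  rw [h, mvfderiv_sub d1 (d2.mul d3), sub_apply, mvfderiv_mul d2 d3, add_apply,
    smul_apply, smul_apply, mvfderiv_pairing hW hZ, mvfderiv_pairing hW hξ,
    mvfderiv_pairing hZ hξ, S.leviCivita_ξ] at h1
  simp only [derivφ, inner_sub_left, inner_sub_right, S.inner_φ_φ]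
  simp only [pairing, smul_eq_mul, inner_neg_right] at h1
  linarith

/-- A 3-dimensional K-contact manifold is Sasakian: `(∇_v φ) W = g(v, W) ξ - η(W) v`. -/
theorem leviCivita_φ {W : Π x : M, TangentSpace (𝓡 3) x} {x : M} (hW : FieldDiffAt W x)
    (v : TangentSpace (𝓡 3) x) :
    leviCivita (𝓡 3) (fun y ↦ S.φ y (W y)) x v
      = S.φ x (leviCivita (𝓡 3) W x v) + (inner ℝ v (W x) : ℝ) • S.ξ x
        - (inner ℝ (W x) (S.ξ x) : ℝ) • v := by
  let D : (Π x : M, TangentSpace (𝓡 3) x) → TangentSpace (𝓡 3) x := fun W ↦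
    S.derivφ W x v - ((inner ℝ v (W x) : ℝ) • S.ξ x - (inner ℝ (W x) (S.ξ x) : ℝ) • v)
  have hDskew {W Z : Π x : M, TangentSpace (𝓡 3) x} (hW : FieldDiffAt W x)
      (hZ : FieldDiffAt Z x) : (inner ℝ (D W) (Z x) : ℝ) = - inner ℝ (W x) (D Z) := by
    have := S.inner_derivφ_skew hW hZ v
    simp only [D, inner_sub_left, inner_sub_right, this, inner_smul_left, inner_smul_right,
      conj_trivial]
    rw [real_inner_comm v (W x), real_inner_comm (S.ξ x) (Z x)]
    ring
  have hDφ {W Z : Π x : M, TangentSpace (𝓡 3) x} (hW : FieldDiffAt W x)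
      (hZ : FieldDiffAt Z x) :
      (inner ℝ (D W) (S.φ x (Z x)) : ℝ) + inner ℝ (S.φ x (W x)) (D Z) = 0 := by
    have := S.inner_derivφ_φ hW hZ v
    simp only [D, inner_sub_left, inner_sub_right, inner_smul_left, inner_smul_right,
      conj_trivial, S.inner_ξ_φ]
    have h (w : TangentSpace (𝓡 3) x) : (inner ℝ v (S.φ x w) : ℝ) = - inner ℝ w (S.φ x v) := by
      rw [S.inner_φ, real_inner_comm]
    rw [real_inner_comm (S.ξ x) (S.φ x (W x)), S.inner_ξ_φ, real_inner_comm v (S.φ x (W x)), h, h]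
    linarith
  have hDξ : D S.ξ = 0 := by
    simp only [D, S.derivφ_ξ, S.inner_ξ_ξ]
    module
  obtain ⟨e, he0, he1, he2⟩ := S.exists_adapted_basis x
  have hD_ξ {U : Π x : M, TangentSpace (𝓡 3) x} (hU : FieldDiffAt U x) :
      (inner ℝ (D U) (e 0) : ℝ) = 0 := by
    rw [he0, hDskew hU (S.mdifferentiableAt_ξ x), hDξ, inner_zero_right, neg_zero]
  have hDself {U : Π x : M, TangentSpace (𝓡 3) x} (hU : FieldDiffAt U x) :
      (inner ℝ (D U) (U x) : ℝ) = 0 := by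
    have := hDskew hU hU
    rw [real_inner_comm (D U)] at this
    linarith
  have hDφself {U : Π x : M, TangentSpace (𝓡 3) x} (hU : FieldDiffAt U x) :
      (inner ℝ (D U) (S.φ x (U x)) : ℝ) = 0 := by
    have := hDφ hU hU
    rw [real_inner_comm (D U)] at this
    linarith
  obtain ⟨U₁, hU₁, hUe₁⟩ := exists_mdifferentiableAt_eq (I := 𝓡 3) x (e 1)
  obtain ⟨U₂, hU₂, hUe₂⟩ := exists_mdifferentiableAt_eq (I := 𝓡 3) x (e 2)
  have hD₁ : D U₁ = 0 := by
    refine InnerProductSpace.ext_inner_right_basis e.toBasis fun i ↦ ?_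
    have h1 := hDself hU₁
    have h2 := hDφself hU₁
    rw [hUe₁] at h1 h2
    rw [he1] at h2
    rw [e.coe_toBasis, inner_zero_left]
    fin_cases i
    exacts [hD_ξ hU₁, h1, h2]
  have hD₂ : D U₂ = 0 := by
    refine InnerProductSpace.ext_inner_right_basis e.toBasis fun i ↦ ?_
    have h1 := hDself hU₂
    have h2 := hDφself hU₂
    rw [hUe₂] at h1 h2
    rw [he2, inner_neg_right, neg_eq_zero] at h2
    rw [e.coe_toBasis, inner_zero_left]
    fin_cases i
    exacts [hD_ξ hU₂, h2, h1]
  have hD : D W = 0 := by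
    refine InnerProductSpace.ext_inner_right_basis e.toBasis fun i ↦ ?_
    have h1 := hDskew hW hU₁
    have h2 := hDskew hW hU₂
    rw [hUe₁, hD₁, inner_zero_right, neg_zero] at h1
    rw [hUe₂, hD₂, inner_zero_right, neg_zero] at h2
    rw [e.coe_toBasis, inner_zero_left]
    fin_cases i
    exacts [hD_ξ hW, h1, h2]
  simp only [D, derivφ] at hD
  rw [← sub_eq_zero, ← hD]
  abel

end SasakianStructure

section LinearAlgebra

variable {V : Type*} [NormedAddCommGroup V] [InnerProductSpace ℝ V]

theorem rotation_skew_part {e : OrthonormalBasis (Fin 3) ℝ V} {φ H : V →L[ℝ] V} {W : V}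
    (h0 : φ (e 0) = 0) (h1 : φ (e 1) = e 2) (h2 : φ (e 2) = - e 1)
    (hH : ∀ v w, (inner ℝ (H v) w : ℝ) = inner ℝ (H w) v) (hW : (inner ℝ W (e 0) : ℝ) = 0)
    (hHW : ∀ v, (inner ℝ (H v) (e 0) : ℝ) = inner ℝ W (φ v)) (v w : V) :
    (inner ℝ (φ (H v)) w - inner ℝ (φ (H w)) v + inner ℝ v W * inner ℝ (e 0) w
      - inner ℝ w W * inner ℝ (e 0) v : ℝ)
      = -(∑ i, inner ℝ (e i) (H (e i))) * inner ℝ v (φ w) := by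
  obtain ⟨e00, e01, e02, e10, e11, e12, e20, e21, e22⟩ := inner_three e
  have hφH (i j : Fin 3) : (inner ℝ (φ (H (e i))) (e j) : ℝ)
      = inner ℝ (H (e i)) (e 1) * inner ℝ (e 2) (e j)
        - inner ℝ (H (e i)) (e 2) * inner ℝ (e 1) (e j) := by
    conv_lhs => rw [← e.sum_repr' (H (e i))]
    simp only [Fin.sum_univ_three, map_add, map_smul, h0, h1, h2, inner_add_left, inner_smul_left,
      inner_neg_left, inner_zero_left, conj_trivial]
    rw [real_inner_comm (H (e i)) (e 1), real_inner_comm (H (e i)) (e 2)]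
    ring
  have k0 := hHW (e 0)
  have k1 := hHW (e 1)
  have k2 := hHW (e 2)
  rw [h0, inner_zero_right] at k0
  rw [h1] at k1
  rw [h2, inner_neg_right] at k2
  have s1 := hH (e 0) (e 1)
  have s2 := hH (e 0) (e 2)
  have s3 := hH (e 1) (e 2)
  obtain ⟨v0, v1, v2, rfl⟩ := exists_eq_sum_three e v
  obtain ⟨w0, w1, w2, rfl⟩ := exists_eq_sum_three e w
  simp only [Fin.sum_univ_three, map_add, map_smul, h0, h1, h2, inner_add_left, inner_smul_left,
    inner_add_right, inner_smul_right, inner_neg_right, inner_zero_right, conj_trivial, hφH,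
    e00, e01, e02, e10, e11, e12, e20, e21, e22, real_inner_comm W, hW,
    real_inner_comm (H _) (e _), k0, k1, k2, s1, s2, s3]
  ring

/-- The matrix of the rotation `φ` about `ξ` in an orthonormal basis whose orientation is
prescribed by the sign of the trilinear expression in the hypothesis. -/
theorem rotation_matrix {e : OrthonormalBasis (Fin 3) ℝ V} {ξ : V} {φ : V →L[ℝ] V}
    (hξ : (inner ℝ ξ ξ : ℝ) = 1) (hφξ : φ ξ = 0)
    (hφ : ∀ v w, (inner ℝ v (φ w) : ℝ) = - inner ℝ (φ v) w)
    (hsq : ∀ v, φ (φ v) = - v + (inner ℝ v ξ : ℝ) • ξ)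
    (hpos : 0 < (inner ℝ (e 0) ξ * inner ℝ (e 1) (φ (e 2))
      + inner ℝ (e 1) ξ * inner ℝ (e 2) (φ (e 0)) + inner ℝ (e 2) ξ * inner ℝ (e 0) (φ (e 1)) : ℝ)) :
    (inner ℝ (e 1) (φ (e 2)) : ℝ) = inner ℝ (e 0) ξ ∧
      (inner ℝ (e 2) (φ (e 0)) : ℝ) = inner ℝ (e 1) ξ ∧
        (inner ℝ (e 0) (φ (e 1)) : ℝ) = inner ℝ (e 2) ξ := by
  have hskew (i j : Fin 3) : (inner ℝ (e i) (φ (e j)) : ℝ) = - inner ℝ (e j) (φ (e i)) := by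
    rw [hφ, real_inner_comm]
  have hdiag (i : Fin 3) : (inner ℝ (e i) (φ (e i)) : ℝ) = 0 := by linarith [hskew i i]
  have hker (i : Fin 3) : ∑ j, (inner ℝ (e j) ξ * inner ℝ (e j) (φ (e i)) : ℝ) = 0 := by
    have := e.sum_inner_mul_inner ξ (φ (e i))
    simp_rw [real_inner_comm (e _) ξ] at this
    rw [this, hφ, hφξ, inner_zero_left, neg_zero]
  have hnorm (i : Fin 3) : ∑ j, (inner ℝ (e j) (φ (e i)) * inner ℝ (e j) (φ (e i)) : ℝ)
      = 1 - inner ℝ (e i) ξ * inner ℝ (e i) ξ := by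
    have := e.sum_inner_mul_inner (φ (e i)) (φ (e i))
    simp_rw [real_inner_comm (e _) (φ (e i))] at this
    rw [this, ← neg_eq_iff_eq_neg.2 (hφ (e i) (φ (e i))), hsq, inner_add_right, inner_neg_right,
      inner_smul_right, orthonormal_iff_ite.1 e.orthonormal, if_pos rfl]
    ring
  have hx := e.sum_inner_mul_inner ξ ξ
  simp_rw [real_inner_comm (e _) ξ, hξ] at hx
  have k0 := hker 0
  have k1 := hker 1
  have k2 := hker 2
  have n0 := hnorm 0
  have n1 := hnorm 1
  have n2 := hnorm 2
  simp only [Fin.sum_univ_three, hdiag, hskew 0 2, hskew 1 0, hskew 2 1] at *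
  generalize (inner ℝ (e 0) ξ : ℝ) = x0 at *
  generalize (inner ℝ (e 1) ξ : ℝ) = x1 at *
  generalize (inner ℝ (e 2) ξ : ℝ) = x2 at *
  generalize (inner ℝ (e 1) (φ (e 2)) : ℝ) = a at *
  generalize (inner ℝ (e 2) (φ (e 0)) : ℝ) = b at *
  generalize (inner ℝ (e 0) (φ (e 1)) : ℝ) = c at *
  have ha : a = (x0 * a + x1 * b + x2 * c) * x0 := by
    linear_combination -a * hx + x1 * k2 - x2 * k1
  have hb : b = (x0 * a + x1 * b + x2 * c) * x1 := by
    linear_combination -b * hx - x0 * k2 + x2 * k0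
  have hc : c = (x0 * a + x1 * b + x2 * c) * x2 := by
    linear_combination -c * hx + x0 * k1 - x1 * k0
  generalize x0 * a + x1 * b + x2 * c = l at *
  subst ha hb hc
  have hl : l ^ 2 = 1 := by linear_combination (n0 + n1 + n2) / 2 - (l ^ 2 + 1 / 2) * hx
  have hl1 : l = 1 := by nlinarith
  simp [hl1]

theorem cross_rotation {e : OrthonormalBasis (Fin 3) ℝ V} {ξ : V} {φ : V →L[ℝ] V} {Y : V} {s : ℝ}
    (hφ : ∀ v w, (inner ℝ v (φ w) : ℝ) = - inner ℝ (φ v) w)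
    (h12 : (inner ℝ (e 1) (φ (e 2)) : ℝ) = inner ℝ (e 0) ξ)
    (h20 : (inner ℝ (e 2) (φ (e 0)) : ℝ) = inner ℝ (e 1) ξ)
    (h01 : (inner ℝ (e 0) (φ (e 1)) : ℝ) = inner ℝ (e 2) ξ) {β : V → V → ℝ}
    (hβ : ∀ v w, β v w = inner ℝ Y v * inner ℝ w ξ - inner ℝ Y w * inner ℝ v ξ
      + s * inner ℝ v (φ w)) :
    β (e 1) (e 2) • e 0 + β (e 2) (e 0) • e 1 + β (e 0) (e 1) • e 2 = s • ξ + φ Y := by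
  have hskew (i j : Fin 3) : (inner ℝ (e i) (φ (e j)) : ℝ) = - inner ℝ (e j) (φ (e i)) := by
    rw [hφ, real_inner_comm]
  have hdiag (i : Fin 3) : (inner ℝ (e i) (φ (e i)) : ℝ) = 0 := by linarith [hskew i i]
  have hYφ (i : Fin 3) : (inner ℝ (e i) (φ Y) : ℝ)
      = - ∑ j, inner ℝ Y (e j) * inner ℝ (e j) (φ (e i)) := by
    rw [e.sum_inner_mul_inner, hφ, real_inner_comm]
  rw [← e.sum_repr' (s • ξ + φ Y)]
  simp only [Fin.sum_univ_three, inner_add_right, inner_smul_right, hYφ, hβ, hdiag, hskew 0 2,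
    hskew 1 0, hskew 2 1, h12, h20, h01]
  module

end LinearAlgebra

namespace SasakianStructure

variable {M : Type*} [TopologicalSpace M] [ChartedSpace (EuclideanSpace ℝ (Fin 3)) M]
  [IsManifold (𝓡 3) ∞ M] [RiemannianBundle (fun x : M ↦ TangentSpace (𝓡 3) x)]
  [IsContMDiffRiemannianBundle (𝓡 3) ∞ (EuclideanSpace ℝ (Fin 3))
    (fun x : M ↦ TangentSpace (𝓡 3) x)]
  (S : SasakianStructure M)

/-- The vector field `a ξ + φ(grad f)`. -/
def vectorField (a f : M → ℝ) (x : M) : TangentSpace (𝓡 3) x :=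
  a x • S.ξ x + S.φ x (grad (𝓡 3) f x)

variable {a f : M → ℝ}

theorem contMDiff_vectorField (ha : ContMDiff (𝓡 3) 𝓘(ℝ, ℝ) ∞ a)
    (hf : ContMDiff (𝓡 3) 𝓘(ℝ, ℝ) ∞ f) : SmoothField (S.vectorField a f) :=
  ContMDiff.add_section (ContMDiff.smul_section ha S.contMDiff_ξ)
    (S.contMDiff_φ_apply (contMDiff_grad hf))

theorem leviCivita_vectorField (ha : ContMDiff (𝓡 3) 𝓘(ℝ, ℝ) ∞ a)
    (hf : ContMDiff (𝓡 3) 𝓘(ℝ, ℝ) ∞ f) {x : M} (v : TangentSpace (𝓡 3) x) :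
    leviCivita (𝓡 3) (S.vectorField a f) x v
      = mvfderiv (𝓡 3) a x v • S.ξ x - a x • S.φ x v
        + (S.φ x (leviCivita (𝓡 3) (grad (𝓡 3) f) x v)
          + (inner ℝ v (grad (𝓡 3) f x) : ℝ) • S.ξ x
          - (inner ℝ (grad (𝓡 3) f x) (S.ξ x) : ℝ) • v) := by
  have hg : FieldDiffAt (grad (𝓡 3) f) x := (contMDiff_grad hf x).mdifferentiableAt (by simp)
  have ha' : MDifferentiableAt (𝓡 3) 𝓘(ℝ, ℝ) a x := ha.mdifferentiableAt (by simp)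
  have hξ := S.mdifferentiableAt_ξ x
  have h : S.vectorField a f = (fun y ↦ a y • S.ξ y) + fun y ↦ S.φ y (grad (𝓡 3) f y) := rfl
  rw [h, leviCivita_add (Y := fun y ↦ a y • S.ξ y) (ha'.smul_section hξ) (S.mdifferentiableAt_φ hg),
    leviCivita_smul ha' hξ, S.leviCivita_φ hg, S.leviCivita_ξ, smul_neg, ← sub_eq_add_neg]

theorem div_vectorField (ha : ContMDiff (𝓡 3) 𝓘(ℝ, ℝ) ∞ a)
    (hf : ContMDiff (𝓡 3) 𝓘(ℝ, ℝ) ∞ f) (x : M) :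
    div (𝓡 3) (S.vectorField a f) x
      = mvfderiv (𝓡 3) a x (S.ξ x) - 2 * mvfderiv (𝓡 3) f x (S.ξ x) := by
  obtain ⟨e, h0, h1, h2⟩ := S.exists_adapted_basis x
  obtain ⟨e00, e01, e02, e10, e11, e12, e20, e21, e22⟩ := inner_three e
  have hφ0 : S.φ x (e 0) = 0 := by rw [h0, S.φ_ξ]
  have hs : (inner ℝ (e 2) (leviCivita (𝓡 3) (grad (𝓡 3) f) x (e 1)) : ℝ)
      = inner ℝ (e 1) (leviCivita (𝓡 3) (grad (𝓡 3) f) x (e 2)) := by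
    rw [real_inner_comm, inner_leviCivita_grad_comm hf, real_inner_comm]
  rw [div, LinearMap.trace_eq_sum_inner _ e, Fin.sum_univ_three]
  simp only [ContinuousLinearMap.coe_coe, S.leviCivita_vectorField ha hf, ← inner_grad f, ← h0,
    inner_add_right, inner_sub_right, inner_smul_right, S.inner_φ, hφ0, h1, h2, inner_neg_left,
    inner_neg_right, inner_zero_left, inner_zero_right, hs, real_inner_comm (grad (𝓡 3) f x) (e 0),
    e00, e10, e11, e12, e20, e21, e22]
  ring

theorem extDerivOneForm_vectorField (ha : ContMDiff (𝓡 3) 𝓘(ℝ, ℝ) ∞ a)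
    (hf : ContMDiff (𝓡 3) 𝓘(ℝ, ℝ) ∞ f) (hξf : ∀ x, mvfderiv (𝓡 3) f x (S.ξ x) = 0) (x : M)
    (v w : TangentSpace (𝓡 3) x) :
    extDerivOneForm (𝓡 3) (flat (𝓡 3) (S.vectorField a f)) x v w
      = inner ℝ (grad (𝓡 3) a x) v * inner ℝ w (S.ξ x)
        - inner ℝ (grad (𝓡 3) a x) w * inner ℝ v (S.ξ x)
        + (laplacian (𝓡 3) f x + 2 * a x) * inner ℝ v (S.φ x w) := by
  obtain ⟨e, h0, h1, h2⟩ := S.exists_adapted_basis x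
  have hg : FieldDiffAt (grad (𝓡 3) f) x := (contMDiff_grad hf x).mdifferentiableAt (by simp)
  have hφ0 : S.φ x (e 0) = 0 := by rw [h0, S.φ_ξ]
  have hW : (inner ℝ (grad (𝓡 3) f x) (e 0) : ℝ) = 0 := by rw [h0, inner_grad, hξf]
  have hHW (v) : (inner ℝ (leviCivita (𝓡 3) (grad (𝓡 3) f) x v) (e 0) : ℝ)
      = inner ℝ (grad (𝓡 3) f x) (S.φ x v) := by
    have hp : pairing (𝓡 3) (grad (𝓡 3) f) S.ξ = fun _ ↦ 0 := by
      rw [pairing_grad]; exact funext hξf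
    rw [h0, inner_leviCivita_eq hg (S.mdifferentiableAt_ξ x), hp, mvfderiv_const, S.leviCivita_ξ]
    simp
  have key := rotation_skew_part hφ0 h1 h2 (inner_leviCivita_grad_comm hf) hW hHW v w
  have hu : FieldDiffAt (S.vectorField a f) x :=
    (S.contMDiff_vectorField ha hf x).mdifferentiableAt (by simp)
  have hΔ : laplacian (𝓡 3) f x
      = -∑ i, (inner ℝ (e i) (leviCivita (𝓡 3) (grad (𝓡 3) f) x (e i)) : ℝ) := by
    rw [laplacian, div, LinearMap.trace_eq_sum_inner _ e]
    rfl
  rw [extDerivOneForm_flat hu, S.leviCivita_vectorField ha hf, S.leviCivita_vectorField ha hf, hΔ]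
  rw [h0] at hW key
  simp only [inner_add_left, inner_sub_left, inner_smul_left, conj_trivial, hW, inner_grad]
  rw [real_inner_comm (S.ξ x) w, real_inner_comm (S.ξ x) v, real_inner_comm v (S.φ x w)]
  linear_combination key - a x * S.inner_φ x v w

end SasakianStructure

theorem contDiff_intervalIntegral {g : ℝ → ℝ} (hg : ContDiff ℝ ∞ g) (a : ℝ) :
    ContDiff ℝ ∞ fun t ↦ ∫ q in a..t, g q := by
  rw [contDiff_infty_iff_deriv]
  have h : deriv (fun t ↦ ∫ q in a..t, g q) = g :=
    funext fun t ↦ (hg.continuous.integral_hasStrictDerivAt a t).hasDerivAt.deriv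
  exact ⟨fun t ↦ (hg.continuous.integral_hasStrictDerivAt a t).hasDerivAt.differentiableAt,
    by rwa [h]⟩

section Functions

variable {M : Type*} [TopologicalSpace M] [ChartedSpace (EuclideanSpace ℝ (Fin 3)) M]

theorem mvfderiv_comp_real {g : ℝ → ℝ} {ψ : M → ℝ} {x : M} (hg : DifferentiableAt ℝ g (ψ x))
    (hψ : MDifferentiableAt (𝓡 3) 𝓘(ℝ, ℝ) ψ x) (v : TangentSpace (𝓡 3) x) :
    mvfderiv (𝓡 3) (fun y ↦ g (ψ y)) x v = deriv g (ψ x) * mvfderiv (𝓡 3) ψ x v := by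
  have h := mvfderiv_comp_apply (I := 𝓘(ℝ, ℝ)) (I' := 𝓡 3) (g := g) x hg.mdifferentiableAt hψ v
  refine h.trans ?_
  simp only [mvfderiv, mfderiv_eq_fderiv]
  exact (fderiv_eq_smul_deriv (𝕜 := ℝ) (f := g) (x := ψ x) (mvfderiv (𝓡 3) ψ x v)).trans
    (mul_comm _ _)

variable [IsManifold (𝓡 3) ∞ M]

/-- A smooth function is open at the points where its differential does not vanish. -/
theorem image_mem_nhds_of_mvfderiv_ne_zero {ψ : M → ℝ} (hψ : ContMDiff (𝓡 3) 𝓘(ℝ, ℝ) ∞ ψ) {x : M}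
    (hx : mvfderiv (𝓡 3) ψ x ≠ 0) {s : Set M} (hs : s ∈ nhds x) : ψ '' s ∈ nhds (ψ x) := by
  have h1 : ContDiffAt ℝ ∞ (writtenInExtChartAt (𝓡 3) 𝓘(ℝ, ℝ) x ψ) (extChartAt (𝓡 3) x x) := by
    have := (contMDiffAt_iff.1 (hψ x)).2
    rwa [ModelWithCorners.range_eq_univ, contDiffWithinAt_univ] at this
  have h2 := h1.hasStrictFDerivAt (by simp)
  have h3 : (fderiv ℝ (writtenInExtChartAt (𝓡 3) 𝓘(ℝ, ℝ) x ψ) (extChartAt (𝓡 3) x x)) ≠ 0 := by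
    rw [MDifferentiableAt.mvfderiv (hψ.mdifferentiableAt (by simp)),
      ModelWithCorners.range_eq_univ, fderivWithin_univ] at hx
    exact hx
  have h4 := h2.map_nhds_eq_of_surj (by
    rw [LinearMap.range_eq_top]
    exact LinearMap.surjective fun h ↦ h3 (ContinuousLinearMap.coe_injective h))
  have h5 : (extChartAt (𝓡 3) x).symm ⁻¹' s ∈ nhds (extChartAt (𝓡 3) x x) :=
    (continuousAt_extChartAt_symm x).preimage_mem_nhds (by rwa [extChartAt_to_inv])
  have h6 := Filter.image_mem_map (m := writtenInExtChartAt (𝓡 3) 𝓘(ℝ, ℝ) x ψ) h5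
  rw [h4] at h6
  simp only [writtenInExtChartAt, extChartAt_model_space_eq_id, PartialEquiv.refl_coe,
    Function.comp_apply, id, extChartAt_to_inv] at h6
  refine Filter.mem_of_superset h6 ?_
  rintro _ ⟨y, hy, rfl⟩
  exact ⟨_, hy, rfl⟩

end Functions

namespace SasakianStructure

variable {M : Type*} [TopologicalSpace M] [ChartedSpace (EuclideanSpace ℝ (Fin 3)) M]
  [IsManifold (𝓡 3) ∞ M] [RiemannianBundle (fun x : M ↦ TangentSpace (𝓡 3) x)]
  [IsContMDiffRiemannianBundle (𝓡 3) ∞ (EuclideanSpace ℝ (Fin 3))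
    (fun x : M ↦ TangentSpace (𝓡 3) x)]
  (S : SasakianStructure M) {a f : M → ℝ}

/-- The form `η ∧ dη` is a multiple of the determinant in any orthonormal basis. -/
theorem wedgeSelfDeriv_η (x : M) (e : OrthonormalBasis (Fin 3) ℝ (TangentSpace (𝓡 3) x))
    (v : Fin 3 → TangentSpace (𝓡 3) x) :
    wedgeSelfDeriv S.η x v = e.toBasis.det v * wedgeSelfDeriv S.η x e := by
  have hskew (i j : Fin 3) : (inner ℝ (e i) (S.φ x (e j)) : ℝ) = - inner ℝ (e j) (S.φ x (e i)) := by
    rw [S.inner_φ, real_inner_comm]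
  have hdiag (i : Fin 3) : (inner ℝ (e i) (S.φ x (e i)) : ℝ) = 0 := by linarith [hskew i i]
  have hv (i : Fin 3) : v i = (inner ℝ (e 0) (v i) : ℝ) • e 0 + (inner ℝ (e 1) (v i) : ℝ) • e 1
      + (inner ℝ (e 2) (v i) : ℝ) • e 2 := by
    rw [← Fin.sum_univ_three (fun j ↦ inner ℝ (e j) (v i) • e j), e.sum_repr']
  rw [Module.Basis.det_apply, Matrix.det_fin_three]
  simp only [Module.Basis.toMatrix_apply, OrthonormalBasis.coe_toBasis_repr_apply,
    OrthonormalBasis.repr_apply_apply, wedgeSelfDeriv, S.extDerivOneForm_η]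
  have key (i j : Fin 3) : (inner ℝ (v i) (S.φ x (v j)) : ℝ)
      = (inner ℝ (e 0) (v i) * inner ℝ (e 1) (v j) - inner ℝ (e 1) (v i) * inner ℝ (e 0) (v j))
          * inner ℝ (e 0) (S.φ x (e 1))
        + (inner ℝ (e 1) (v i) * inner ℝ (e 2) (v j) - inner ℝ (e 2) (v i) * inner ℝ (e 1) (v j))
          * inner ℝ (e 1) (S.φ x (e 2))
        + (inner ℝ (e 2) (v i) * inner ℝ (e 0) (v j) - inner ℝ (e 0) (v i) * inner ℝ (e 2) (v j))
          * inner ℝ (e 2) (S.φ x (e 0)) := by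
    conv_lhs => rw [hv i, hv j]
    simp only [map_add, map_smul, inner_add_left, inner_smul_left, inner_add_right,
      inner_smul_right, conj_trivial, hdiag, hskew 0 2, hskew 1 0, hskew 2 1]
    ring
  have keyη (i : Fin 3) : S.η x (v i) = inner ℝ (e 0) (v i) * S.η x (e 0)
      + inner ℝ (e 1) (v i) * S.η x (e 1) + inner ℝ (e 2) (v i) * S.η x (e 2) := by
    conv_lhs => rw [hv i]
    simp only [map_add, map_smul, smul_eq_mul]
  simp only [key, keyη]
  ring

theorem wedgeSelfDeriv_pos {x : M} {e : OrthonormalBasis (Fin 3) ℝ (TangentSpace (𝓡 3) x)}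
    (he : e.toBasis.orientation = S.orientation x) : 0 < wedgeSelfDeriv S.η x e := by
  have hne : wedgeSelfDeriv S.η x e ≠ 0 := by
    obtain ⟨v, hv⟩ := S.contact x
    rw [S.wedgeSelfDeriv_η x e] at hv
    exact right_ne_zero_of_mul hv
  obtain ⟨b, ho⟩ : ∃ b : Module.Basis (Fin 3) ℝ (TangentSpace (𝓡 3) x), S.orientation x =
    open scoped Classical in
    if 0 < wedgeSelfDeriv S.η x b then b.orientation else -b.orientation := ⟨_, rfl⟩
  rw [ho] at he
  have hb := S.wedgeSelfDeriv_η x e b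
  split_ifs at he with h
  · have hdet := (Module.Basis.orientation_eq_iff_det_pos _ _).1 he
    rw [hb] at h
    exact (pos_iff_pos_of_mul_pos h).1 hdet
  · have hdet : e.toBasis.det b < 0 := by
      have h0 : e.toBasis.det b ≠ 0 := (e.toBasis.isUnit_det b).ne_zero
      refine lt_of_le_of_ne (not_lt.1 fun hlt ↦ ?_) h0
      rw [(Module.Basis.orientation_eq_iff_det_pos _ _).2 hlt] at he
      exact Module.Ray.ne_neg_self _ he
    rw [hb] at h
    by_contra hw
    exact h (mul_pos_of_neg_of_neg hdet (lt_of_le_of_ne (not_lt.1 hw) hne))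

theorem curl_vectorField (ha : ContMDiff (𝓡 3) 𝓘(ℝ, ℝ) ∞ a)
    (hf : ContMDiff (𝓡 3) 𝓘(ℝ, ℝ) ∞ f) (hξf : ∀ x, mvfderiv (𝓡 3) f x (S.ξ x) = 0) (x : M) :
    curl S.orientation (S.vectorField a f) x
      = (laplacian (𝓡 3) f x + 2 * a x) • S.ξ x + S.φ x (grad (𝓡 3) a x) := by
  rw [curl]
  have he := (S.orientation x).finOrthonormalBasis_orientation (by norm_num)
    (finrank_tangentSpace x)
  generalize (S.orientation x).finOrthonormalBasis _ _ = e at he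
  have hpos := S.wedgeSelfDeriv_pos he
  simp only [wedgeSelfDeriv, S.extDerivOneForm_η, S.η_eq] at hpos
  obtain ⟨h12, h20, h01⟩ := rotation_matrix (e := e) (S.inner_ξ_ξ x) (S.φ_ξ x) (S.inner_φ x)
    (S.φ_φ x) (by linarith)
  exact cross_rotation (S.inner_φ x) h12 h20 h01 (S.extDerivOneForm_vectorField ha hf hξf x)

theorem leviCivita_vectorField_self (ha : ContMDiff (𝓡 3) 𝓘(ℝ, ℝ) ∞ a)
    (hf : ContMDiff (𝓡 3) 𝓘(ℝ, ℝ) ∞ f) (hξf : ∀ x, mvfderiv (𝓡 3) f x (S.ξ x) = 0) {x : M}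
    (haξ : mvfderiv (𝓡 3) a x (S.ξ x) = 0)
    (haf : (inner ℝ (grad (𝓡 3) a x) (S.φ x (grad (𝓡 3) f x)) : ℝ) = 0)
    (v : TangentSpace (𝓡 3) x) :
    inner ℝ (leviCivita (𝓡 3) (S.vectorField a f) x (S.vectorField a f x)) v
      = 1 / 2 * mvfderiv (𝓡 3) (pairing (𝓡 3) (grad (𝓡 3) f) (grad (𝓡 3) f)) x v
        + (laplacian (𝓡 3) f x + 2 * a x) * mvfderiv (𝓡 3) f x v := by
  have hu : FieldDiffAt (S.vectorField a f) x :=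
    (S.contMDiff_vectorField ha hf x).mdifferentiableAt (by simp)
  have hg : FieldDiffAt (grad (𝓡 3) f) x := (contMDiff_grad hf x).mdifferentiableAt (by simp)
  have ha' : MDifferentiableAt (𝓡 3) 𝓘(ℝ, ℝ) a x := ha.mdifferentiableAt (by simp)
  have hW (y : M) : (inner ℝ (grad (𝓡 3) f y) (S.ξ y) : ℝ) = 0 := by rw [inner_grad, hξf]
  have hp : pairing (𝓡 3) (S.vectorField a f) (S.vectorField a f)
      = a * a + pairing (𝓡 3) (grad (𝓡 3) f) (grad (𝓡 3) f) := by
    ext y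
    simp only [pairing, vectorField, Pi.add_apply, Pi.mul_apply, inner_add_left, inner_add_right,
      inner_smul_left, inner_smul_right, conj_trivial, S.inner_ξ_ξ, S.inner_ξ_φ, S.inner_φ_φ, hW,
      real_inner_comm (S.ξ y) (S.φ y _)]
    ring
  have h1 := mvfderiv_pairing hu hu v
  rw [hp, mvfderiv_add (ha'.mul ha') (mdifferentiableAt_pairing (𝓡 3) hg hg), mvfderiv_mul ha' ha',
    real_inner_comm _ (S.vectorField a f x)] at h1
  have h2 := S.extDerivOneForm_vectorField ha hf hξf x (S.vectorField a f x) v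
  rw [extDerivOneForm_flat hu] at h2
  have h3 : (inner ℝ (S.vectorField a f x) (S.ξ x) : ℝ) = a x := by
    simp only [vectorField, inner_add_left, inner_smul_left, S.inner_ξ_ξ, conj_trivial,
      real_inner_comm (S.ξ x) (S.φ x _), S.inner_ξ_φ]
    ring
  have h4 : (inner ℝ (S.vectorField a f x) (S.φ x v) : ℝ) = mvfderiv (𝓡 3) f x v := by
    simp only [vectorField, inner_add_left, inner_smul_left, S.inner_ξ_φ, S.inner_φ_φ, hW,
      inner_grad]
    ring
  have h5 : (inner ℝ (grad (𝓡 3) a x) (S.vectorField a f x) : ℝ) = 0 := by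
    simp only [vectorField, inner_add_right, inner_smul_right, haf, inner_grad, haξ]
    ring
  rw [h3, h4, h5, inner_grad] at h2
  simp only [add_apply, smul_apply, smul_eq_mul] at h1
  linarith

end SasakianStructure

namespace SasakianStructure

variable {M : Type*} [TopologicalSpace M] [ChartedSpace (EuclideanSpace ℝ (Fin 3)) M]
  [IsManifold (𝓡 3) ∞ M] [RiemannianBundle (fun x : M ↦ TangentSpace (𝓡 3) x)]
  [IsContMDiffRiemannianBundle (𝓡 3) ∞ (EuclideanSpace ℝ (Fin 3))
    (fun x : M ↦ TangentSpace (𝓡 3) x)]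
  (S : SasakianStructure M) {ψ : M → ℝ} {F G : ℝ → ℝ}

theorem ansatz_eq_vectorField (F G : ℝ → ℝ) (ψ : M → ℝ) :
    S.ansatz F G ψ = S.vectorField (fun y ↦ F (ψ y)) (fun y ↦ G (ψ y)) := rfl

theorem mvfderiv_comp_contDiff (hψ : ContMDiff (𝓡 3) 𝓘(ℝ, ℝ) ∞ ψ) (hG : ContDiff ℝ ∞ G) (x : M)
    (v : TangentSpace (𝓡 3) x) :
    mvfderiv (𝓡 3) (fun y ↦ G (ψ y)) x v = deriv G (ψ x) * mvfderiv (𝓡 3) ψ x v :=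
  mvfderiv_comp_real (hG.differentiable (by simp) _) (hψ.mdifferentiableAt (by simp)) v

theorem grad_comp_contDiff (hψ : ContMDiff (𝓡 3) 𝓘(ℝ, ℝ) ∞ ψ) (hG : ContDiff ℝ ∞ G) (x : M) :
    grad (𝓡 3) (fun y ↦ G (ψ y)) x = deriv G (ψ x) • grad (𝓡 3) ψ x := by
  refine ext_inner_right ℝ fun v ↦ ?_
  rw [inner_grad, mvfderiv_comp_contDiff hψ hG, inner_smul_left, inner_grad, conj_trivial]

theorem contMDiff_comp_contDiff (hψ : ContMDiff (𝓡 3) 𝓘(ℝ, ℝ) ∞ ψ) (hG : ContDiff ℝ ∞ G) :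
    ContMDiff (𝓡 3) 𝓘(ℝ, ℝ) ∞ (fun y ↦ G (ψ y)) :=
  hG.contMDiff.comp hψ

theorem div_ansatz (hψ : ContMDiff (𝓡 3) 𝓘(ℝ, ℝ) ∞ ψ) (hF : ContDiff ℝ ∞ F)
    (hG : ContDiff ℝ ∞ G) (x : M) :
    div (𝓡 3) (S.ansatz F G ψ) x
      = (deriv F (ψ x) - 2 * deriv G (ψ x)) * mvfderiv (𝓡 3) ψ x (S.ξ x) := by
  rw [ansatz_eq_vectorField, S.div_vectorField (contMDiff_comp_contDiff hψ hF)
    (contMDiff_comp_contDiff hψ hG), mvfderiv_comp_contDiff hψ hF, mvfderiv_comp_contDiff hψ hG]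
  ring

theorem div_ansatz_eq_zero_iff (hψ : ContMDiff (𝓡 3) 𝓘(ℝ, ℝ) ∞ ψ) (hF : ContDiff ℝ ∞ F)
    (hG : ContDiff ℝ ∞ G) (x : M) :
    div (𝓡 3) (S.ansatz F G ψ) x = 0 ↔
      (deriv F (ψ x) = 2 * deriv G (ψ x) ∨ mvfderiv (𝓡 3) ψ x (S.ξ x) = 0) := by
  rw [S.div_ansatz hψ hF hG, mul_eq_zero, sub_eq_zero]

theorem forall_div_ansatz_eq_zero_iff (hψ : ContMDiff (𝓡 3) 𝓘(ℝ, ℝ) ∞ ψ) (hF : ContDiff ℝ ∞ F)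
    (hG : ContDiff ℝ ∞ G) (h : (∀ x, deriv F (ψ x) = 2 * deriv G (ψ x)) ∨
      interior (Set.range ψ ∩ {t | deriv F t = 2 * deriv G t}) = ∅) :
    (∀ x, div (𝓡 3) (S.ansatz F G ψ) x = 0) ↔
      ((∀ x, deriv F (ψ x) = 2 * deriv G (ψ x)) ∨ ∀ x, mvfderiv (𝓡 3) ψ x (S.ξ x) = 0) := by
  simp only [S.div_ansatz_eq_zero_iff hψ hF hG]
  refine ⟨fun hdiv ↦ h.imp_right fun hint x ↦ ?_,
    fun h' x ↦ h'.imp (fun hx ↦ hx x) fun hx ↦ hx x⟩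
  by_contra hx
  have hU : {y | mvfderiv (𝓡 3) ψ y (S.ξ y) ≠ 0} ∈ nhds x :=
    (contMDiffAt_mvfderiv_apply hψ (S.contMDiff_ξ x)).continuousAt.eventually_ne hx
  have himg := image_mem_nhds_of_mvfderiv_ne_zero hψ (fun h0 ↦ hx (by rw [h0]; rfl)) hU
  have hmem : ψ x ∈ interior (Set.range ψ ∩ {t | deriv F t = 2 * deriv G t}) := by
    refine mem_interior_iff_mem_nhds.2 (Filter.mem_of_superset himg ?_)
    rintro _ ⟨y, hy, rfl⟩
    exact ⟨⟨y, rfl⟩, (hdiv y).resolve_right hy⟩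
  rw [hint] at hmem
  exact hmem

theorem curl_ansatz (hψ : ContMDiff (𝓡 3) 𝓘(ℝ, ℝ) ∞ ψ) (hF : ContDiff ℝ ∞ F)
    (hG : ContDiff ℝ ∞ G) (hξ : ∀ x, mvfderiv (𝓡 3) ψ x (S.ξ x) = 0) (x : M) :
    curl S.orientation (S.ansatz F G ψ) x
      = (laplacian (𝓡 3) (fun y ↦ G (ψ y)) x + 2 * F (ψ x)) • S.ξ x
        + deriv F (ψ x) • S.φ x (grad (𝓡 3) ψ x) := by
  rw [ansatz_eq_vectorField, S.curl_vectorField (contMDiff_comp_contDiff hψ hF)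
    (contMDiff_comp_contDiff hψ hG) (fun y ↦ by rw [mvfderiv_comp_contDiff hψ hG, hξ, mul_zero]),
    grad_comp_contDiff hψ hF, map_smul]

/-- The ansatz is a Beltrami field as soon as its two components satisfy the Beltrami equation. -/
theorem isBeltrami_ansatz (hψ : ContMDiff (𝓡 3) 𝓘(ℝ, ℝ) ∞ ψ) (hF : ContDiff ℝ ∞ F)
    (hG : ContDiff ℝ ∞ G) (hξ : ∀ x, mvfderiv (𝓡 3) ψ x (S.ξ x) = 0) {θ : M → ℝ}
    (hθ : ∀ x, laplacian (𝓡 3) (fun y ↦ G (ψ y)) x + 2 * F (ψ x) = θ x * F (ψ x))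
    (hFG : ∀ x, deriv F (ψ x) = θ x * deriv G (ψ x)) : S.IsBeltrami (S.ansatz F G ψ) θ := by
  refine ⟨fun x ↦ (S.div_ansatz_eq_zero_iff hψ hF hG x).2 (.inr (hξ x)), fun x ↦ ?_⟩
  rw [S.curl_ansatz hψ hF hG hξ, hθ, hFG, ansatz, grad_comp_contDiff hψ hG, map_smul]
  module

theorem isSteadyEuler_ansatz (hψ : ContMDiff (𝓡 3) 𝓘(ℝ, ℝ) ∞ ψ) (hF : ContDiff ℝ ∞ F)
    (hG : ContDiff ℝ ∞ G) {𝒢 : ℝ → ℝ} (h𝒢 : ContDiff ℝ ∞ 𝒢)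
    (hξ : ∀ x, mvfderiv (𝓡 3) ψ x (S.ξ x) = 0)
    (hΔ : ∀ x, laplacian (𝓡 3) (fun y ↦ G (ψ y)) x = 𝒢 (ψ x)) :
    IsSteadyEuler (S.ansatz F G ψ)
      (fun x ↦ -(1 / 2) * ‖grad (𝓡 3) (fun y ↦ G (ψ y)) x‖ ^ 2
        - ∫ q in (0 : ℝ)..(ψ x), (𝒢 q + 2 * F q) * deriv G q) := by
  have ha := contMDiff_comp_contDiff hψ hF
  have hf := contMDiff_comp_contDiff hψ hG
  have hg := contMDiff_grad (I := 𝓡 3) hf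
  have hg' : ContDiff ℝ ∞ fun q ↦ (𝒢 q + 2 * F q) * deriv G q :=
    (h𝒢.add (contDiff_const.mul hF)).mul (contDiff_infty_iff_deriv.1 hG).2
  have hP := contDiff_intervalIntegral hg' 0
  have hPψ := contMDiff_comp_contDiff hψ hP
  have hpair : ContMDiff (𝓡 3) 𝓘(ℝ, ℝ) ∞ (pairing (𝓡 3) (grad (𝓡 3) fun y ↦ G (ψ y))
      (grad (𝓡 3) fun y ↦ G (ψ y))) :=
    ContMDiff.inner_bundle (IB := 𝓡 3) (F := EuclideanSpace ℝ (Fin 3))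
      (E := fun x : M ↦ TangentSpace (𝓡 3) x) hg hg
  have hp : (fun x ↦ -(1 / 2) * ‖grad (𝓡 3) (fun y ↦ G (ψ y)) x‖ ^ 2
        - ∫ q in (0 : ℝ)..(ψ x), (𝒢 q + 2 * F q) * deriv G q)
      = fun x ↦ -(1 / 2) * pairing (𝓡 3) (grad (𝓡 3) fun y ↦ G (ψ y))
          (grad (𝓡 3) fun y ↦ G (ψ y)) x
        - ∫ q in (0 : ℝ)..(ψ x), (𝒢 q + 2 * F q) * deriv G q := by
    simp only [pairing, real_inner_self_eq_norm_sq]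
  rw [hp]
  refine ⟨(contMDiff_const.mul hpair).sub hPψ, fun x ↦ ?_,
    fun x ↦ (S.div_ansatz_eq_zero_iff hψ hF hG x).2 (.inr (hξ x))⟩
  refine ext_inner_right ℝ fun v ↦ ?_
  have hφ : (inner ℝ (grad (𝓡 3) ψ x) (S.φ x (grad (𝓡 3) ψ x)) : ℝ) = 0 := by
    have := S.inner_φ x (grad (𝓡 3) ψ x) (grad (𝓡 3) ψ x)
    rw [real_inner_comm (grad (𝓡 3) ψ x) (S.φ x _)] at this
    linarith
  have h1 : MDifferentiableAt (𝓡 3) 𝓘(ℝ, ℝ) (pairing (𝓡 3) (grad (𝓡 3) fun y ↦ G (ψ y))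
      (grad (𝓡 3) fun y ↦ G (ψ y))) x := hpair.mdifferentiableAt (by simp)
  have h3 : MDifferentiableAt (𝓡 3) 𝓘(ℝ, ℝ) (fun y ↦ -(1 / 2) *
      pairing (𝓡 3) (grad (𝓡 3) fun y ↦ G (ψ y)) (grad (𝓡 3) fun y ↦ G (ψ y)) y) x :=
    mdifferentiableAt_const.mul h1
  have h2 : deriv (fun t ↦ ∫ q in (0 : ℝ)..t, (𝒢 q + 2 * F q) * deriv G q) (ψ x)
      = (𝒢 (ψ x) + 2 * F (ψ x)) * deriv G (ψ x) :=
    (hg'.continuous.integral_hasStrictDerivAt 0 (ψ x)).hasDerivAt.deriv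
  rw [ansatz_eq_vectorField, S.leviCivita_vectorField_self ha hf
    (fun y ↦ by rw [mvfderiv_comp_contDiff hψ hG, hξ, mul_zero])
    (by rw [mvfderiv_comp_contDiff hψ hF, hξ, mul_zero])
    (by rw [grad_comp_contDiff hψ hF, grad_comp_contDiff hψ hG, map_smul, inner_smul_left,
      inner_smul_right, hφ, mul_zero, mul_zero]), hΔ, inner_neg_left, inner_grad,
    mvfderiv_fun_sub h3 (hPψ.mdifferentiableAt (by simp)),
    sub_apply, mvfderiv_comp_contDiff hψ hP, mvfderiv_comp_contDiff hψ hG, h2,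
    mvfderiv_fun_mul mdifferentiableAt_const h1, mvfderiv_const]
  simp only [smul_zero, add_zero, smul_apply, smul_eq_mul]
  ring

theorem ansatz_ne_zero {x : M} (h : F (ψ x) ≠ 0) : S.ansatz F G ψ x ≠ 0 := fun h0 ↦ by
  have : (inner ℝ (S.ξ x) (S.ansatz F G ψ x) : ℝ) = F (ψ x) := by
    rw [ansatz, inner_add_right, inner_smul_right, S.inner_ξ_ξ, S.inner_ξ_φ, mul_one, add_zero]
  rw [h0, inner_zero_right] at this
  exact h this.symm

end SasakianStructure

end

end SasakianFlow

theorem mainTheorem4 :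
    -- on an arbitrary Sasakian 3-manifold
    (∀ (M : Type u) [TopologicalSpace M] [T2Space M] [SecondCountableTopology M]
        [ChartedSpace (EuclideanSpace ℝ (Fin 3)) M] [IsManifold (𝓡 3) ∞ M]
        [RiemannianBundle (fun x : M ↦ TangentSpace (𝓡 3) x)]
        [IsContMDiffRiemannianBundle (𝓡 3) ∞ (EuclideanSpace ℝ (Fin 3))
          (fun x : M ↦ TangentSpace (𝓡 3) x)]
        (S : SasakianFlow.SasakianStructure M)
        (ψ : M → ℝ) (_ : ContMDiff (𝓡 3) 𝓘(ℝ, ℝ) ∞ ψ)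
        (F G : ℝ → ℝ) (_ : ContDiff ℝ ∞ F) (_ : ContDiff ℝ ∞ G),
      -- `u` is a smooth vector field
      ContMDiff (𝓡 3) (𝓡 3).tangent ∞
        (fun x ↦ (⟨x, S.ansatz F G ψ x⟩ : TangentBundle (𝓡 3) M)) ∧
      -- (i), pointwise
      (∀ x, SasakianFlow.div (𝓡 3) (S.ansatz F G ψ) x = 0 ↔
        (deriv F (ψ x) = 2 * deriv G (ψ x) ∨ mvfderiv (𝓡 3) ψ x (S.ξ x) = 0)) ∧
      -- (i), global dichotomy
      (((∀ x, deriv F (ψ x) = 2 * deriv G (ψ x)) ∨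
          interior (Set.range ψ ∩ {t | deriv F t = 2 * deriv G t}) = ∅) →
        ((∀ x, SasakianFlow.div (𝓡 3) (S.ansatz F G ψ) x = 0) ↔
          ((∀ x, deriv F (ψ x) = 2 * deriv G (ψ x)) ∨
            ∀ x, mvfderiv (𝓡 3) ψ x (S.ξ x) = 0))) ∧
      -- (ii)
      ((∀ x, deriv G (ψ x) ≠ 0) →
        (∀ x, mvfderiv (𝓡 3) ψ x (S.ξ x) = 0) →
        (∀ x, SasakianFlow.laplacian (𝓡 3) (fun y ↦ G (ψ y)) x =
          F (ψ x) * (deriv F (ψ x) / deriv G (ψ x) - 2)) →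
        S.IsBeltrami (S.ansatz F G ψ) (fun x ↦ deriv F (ψ x) / deriv G (ψ x))) ∧
      -- (iii)
      (∀ 𝒢 : ℝ → ℝ, ContDiff ℝ ∞ 𝒢 →
        (∀ x, mvfderiv (𝓡 3) ψ x (S.ξ x) = 0) →
        (∀ x, SasakianFlow.laplacian (𝓡 3) (fun y ↦ G (ψ y)) x = 𝒢 (ψ x)) →
        SasakianFlow.IsSteadyEuler (S.ansatz F G ψ)
          (fun x ↦ -(1 / 2) * ‖SasakianFlow.grad (𝓡 3) (fun y ↦ G (ψ y)) x‖ ^ 2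
            - ∫ q in (0 : ℝ)..(ψ x), (𝒢 q + 2 * F q) * deriv G q))) ∧
    -- (ii), eigenfields of curl on the round 3-sphere
    (∀ [RiemannianBundle (fun x : SasakianFlow.S3 ↦ TangentSpace (𝓡 3) x)]
        [IsContMDiffRiemannianBundle (𝓡 3) ∞ (EuclideanSpace ℝ (Fin 3))
          (fun x : SasakianFlow.S3 ↦ TangentSpace (𝓡 3) x)]
        (_ : SasakianFlow.IsRound) (S : SasakianFlow.SasakianStructure SasakianFlow.S3)
        (ψ : SasakianFlow.S3 → ℝ) (_ : ContMDiff (𝓡 3) 𝓘(ℝ, ℝ) ∞ ψ)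
        (G : ℝ → ℝ) (_ : ContDiff ℝ ∞ G) (k : ℤ),
      (∀ x, mvfderiv (𝓡 3) ψ x (S.ξ x) = 0) →
      (∃ x, G (ψ x) ≠ 0) →
      (∀ x, SasakianFlow.laplacian (𝓡 3) (fun y ↦ G (ψ y)) x = (k * (k - 2) : ℝ) * G (ψ x)) →
      S.IsBeltrami (S.ansatz (fun t ↦ k * G t) G ψ) (fun _ ↦ (k : ℝ)) ∧
        (k ≠ 0 → ∃ x, S.ansatz (fun t ↦ k * G t) G ψ x ≠ 0)) := by
  refine ⟨fun M _ _ _ _ _ _ _ S ψ hψ F G hF hG ↦ ⟨?_, S.div_ansatz_eq_zero_iff hψ hF hG,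
    S.forall_div_ansatz_eq_zero_iff hψ hF hG, fun hG' hξ hΔ ↦ ?_,
    fun 𝒢 h𝒢 hξ hΔ ↦ S.isSteadyEuler_ansatz hψ hF hG h𝒢 hξ hΔ⟩,
    fun _ S ψ hψ G hG k hξ ⟨x, hx⟩ hΔ ↦ ⟨?_, fun hk ↦ ⟨x, ?_⟩⟩⟩
  · exact S.contMDiff_vectorField (SasakianFlow.SasakianStructure.contMDiff_comp_contDiff hψ hF)
      (SasakianFlow.SasakianStructure.contMDiff_comp_contDiff hψ hG)
  · exact S.isBeltrami_ansatz hψ hF hG hξ (fun x ↦ by rw [hΔ]; ring)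
      fun x ↦ (div_mul_cancel₀ _ (hG' x)).symm
  · exact S.isBeltrami_ansatz hψ (contDiff_const.mul hG) hG hξ (fun x ↦ by rw [hΔ]; ring)
      fun x ↦ deriv_const_mul _ (hG.differentiable (by simp) _)
  · exact S.ansatz_ne_zero (mul_ne_zero (Int.cast_ne_zero.2 hk) hx)
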